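/- **Languages.** Fix sets of primitive operations $\mathsf{op}\in\mathrm{Op}^m_{n_1,\dots,n_k}$ and linear operations $\mathsf{lop}\in\mathrm{LOp}^m_{n_1,\dots,n_k;n'_1,\dots,n'_l}$. The *source language* is the simply typed $\lambda$-calculus with types generated by $\mathbf{real}^n$ ($n\in\mathbb N$), $\mathbf 1$, $\tau*\sigma$, $\tau\to\sigma$ and with term formers $\mathsf{op}(t):\mathbf{real}^m$ for $t:\mathbf{real}^{n_1}*\dots*\mathbf{real}^{n_k}$, up to $\beta\eta$-equality. The *target language* has Cartesian types $\mathbf{real}^n,\mathbf 1,\tau*\sigma,\tau\to\sigma,\underline\tau\multimap\underline\sigma$, linear types $\underline{\mathbf{real}}^n,\underline{\mathbf 1},\underline\tau*\underline\sigma,\tau\to\underline\sigma,\,!\tau\otimes\underline\sigma$, and judgements $\Gamma\vdash t:\tau$ and $\Gamma;y:\underline\tau\vdash t:\underline\sigma$ (with $t$ linear in $y$); its terms are the source constructs, $\mathsf{lop}(t;s)$, tuples and projections, abstraction and application for all function types, $!t\otimes s$ and its pattern match, and $0$, $t+s$ on linear types. Its terms are taken up to $\beta\eta{+}$-equality: the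 $\beta\eta$-laws of all type formers, the commutative monoid laws for $(0,+)$, and $t[0/y]=0$, $t[s+r/y]=t[s/y]+t[r/y]$ for the linear variable $y$. **Categories.** $\mathbf{Syn}$ has the source types as objects and terms $x:\tau\vdash t:\sigma$ modulo $\beta\eta$ as morphisms. $\mathbf{CSyn}$ has the Cartesian types as objects and terms $x:\tau\vdash t:\sigma$ modulo $\beta\eta{+}$ as morphisms. For a Cartesian type $\tau$, the category $\mathbf{LSyn}(\tau)$ has the linear types as objects and terms $x:\tau;y:\underline\sigma\vdash t:\underline\rho$ modulo $\beta\eta{+}$ as morphisms. Composition and change of base are substitution. The objects of $\Sigma_{\mathbf{CSyn}}\mathbf{LSyn}$ and of $\Sigma_{\mathbf{CSyn}}\mathbf{LSyn}^{op}$ are pairs $(A_1,A_2)$ of a Cartesian and a linear type; a morphism $(A_1,A_2)\to(B_1,B_2)$ is a pair $(f_1,f_2)$ with $f_1:A_1\to B_1$ in $\mathbf{CSyn}$ and $f_2:A_2\to B_2$, respectively $f_2:B_2\to A_2$, in $\mathbf{LSyn}(A_1)$; composition is $(f_1,f_2);(g_1,g_2)=(f_1;g_1,\ f_2;\mathbf{LSyn}(f_1)(g_2))$,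 respectively $(f_1;g_1,\ \mathbf{LSyn}(f_1)(g_2);f_2)$. **Statement.** $\mathbf{Syn}$, $\Sigma_{\mathbf{CSyn}}\mathbf{LSyn}$ and $\Sigma_{\mathbf{CSyn}}\mathbf{LSyn}^{op}$ are Cartesian closed: $\mathbf{Syn}$ with terminal object $\mathbf 1$, products $\tau*\sigma$ and exponentials $\tau\to\sigma$, and the two others with terminal object $(\mathbf 1,\underline{\mathbf 1})$, products $(A_1*B_1,A_2*B_2)$ and exponentials of $(B_1,B_2)$ by $(A_1,A_2)$ $$\bigl(A_1\to(B_1*(A_2\multimap B_2)),\ A_1\to B_2\bigr),\quad\text{respectively}\quad\bigl(A_1\to(B_1*(B_2\multimap A_2)),\ !A_1\otimes B_2\bigr).$$ Choose, for each $\mathsf{op}\in\mathrm{Op}^m_{n_1,\dots,n_k}$, a term $x:\mathbf{real}^{n_1}*\dots*\mathbf{real}^{n_k};\,y:\underline{\mathbf{real}}^{n_1}*\dots*\underline{\mathbf{real}}^{n_k}\vdash D\mathsf{op}(x;y):\underline{\mathbf{real}}^m$ (to represent its derivative) and a term $x:\mathbf{real}^{n_1}*\dots*\mathbf{real}^{n_k};\,y:\underline{\mathbf{real}}^m\vdash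 D\mathsf{op}^t(x;y):\underline{\mathbf{real}}^{n_1}*\dots*\underline{\mathbf{real}}^{n_k}$ (to represent its transposed derivative). Then, where Cartesian closed functors preserve the chosen structure strictly: 1. there is a unique Cartesian closed functor $\overrightarrow{\mathcal D}:\mathbf{Syn}\to\Sigma_{\mathbf{CSyn}}\mathbf{LSyn}$ (forward AD) with $\overrightarrow{\mathcal D}(\mathbf{real}^n)=(\mathbf{real}^n,\underline{\mathbf{real}}^n)$ and $\overrightarrow{\mathcal D}(\mathsf{op})=(\mathsf{op},D\mathsf{op})$ for all $n$ and $\mathsf{op}$; 2. there is a unique Cartesian closed functor $\overleftarrow{\mathcal D}:\mathbf{Syn}\to\Sigma_{\mathbf{CSyn}}\mathbf{LSyn}^{op}$ (reverse AD) with $\overleftarrow{\mathcal D}(\mathbf{real}^n)=(\mathbf{real}^n,\underline{\mathbf{real}}^n)$ and $\overleftarrow{\mathcal D}(\mathsf{op})=(\mathsf{op},D\mathsf{op}^t)$ for all $n$ and $\mathsf{op}$; 3. if two source programs $x:\tau\vdash t,s:\sigma$ are $\beta\eta$-equal, then any terms representing $\overrightarrow{\mathcal D}(t)$ and $\overrightarrow{\mathcal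 D}(s)$, and any terms representing $\overleftarrow{\mathcal D}(t)$ and $\overleftarrow{\mathcal D}(s)$, are componentwise $\beta\eta{+}$-equal. -/

import Mathlib

open CategoryTheory

universe u v u₁ v₁ u₂ v₂

set_option linter.checkUnivs false

namespace AD

/-! ## Signatures, variables and renamings -/

/-- The primitive operations: `Op [n₁,…,nₖ] m` is the set of operations
`realⁿ¹ * … * realⁿᵏ → realᵐ`, and `LOp [n₁,…,nₖ] [n'₁,…,n'ₗ] m` is the set of operations which are
linear in the last `l` arguments. -/
structure Sig : Type (max (u + 1) (v + 1)) where
  Op : List ℕ → ℕ → Type u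
  LOp : List ℕ → List ℕ → ℕ → Type v

/-- Typed de Bruijn variables. -/
inductive Var {T : Type} : List T → T → Type
  | z {Γ : List T} {τ : T} : Var (τ :: Γ) τ
  | s {Γ : List T} {τ σ : T} : Var Γ τ → Var (σ :: Γ) τ

/-- There are no variables in the empty context. -/
def Var.elim {T : Type} {τ : T} {α : Sort u} (a : Var ([] : List T) τ) : α := nomatch a

/-- Renamings. -/
def Ren {T : Type} (Γ Δ : List T) : Type := ∀ τ : T, Var Γ τ → Var Δ τ

/-- Renaming under a binder. -/
def Ren.lift {T : Type} {Γ Δ : List T} (ρ : Ren Γ Δ) (σ : T) : Ren (σ :: Γ) (σ :: Δ)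
  | _, .z => .z
  | _, .s a => .s (ρ _ a)

/-- Weakening. -/
def Ren.wk {T : Type} (Γ : List T) (σ : T) : Ren Γ (σ :: Γ) := fun _ a => .s a

theorem Ren.lift_comp {T : Type} {Γ Δ Θ : List T} (ρ : Ren Γ Δ) (ρ' : Ren Δ Θ) (σ : T) :
    (fun τ a => ρ'.lift σ τ (ρ.lift σ τ a)) = Ren.lift (fun τ a => ρ' τ (ρ τ a)) σ := by
  funext τ a; cases a <;> rfl

/-! ## The source language -/

/-- Types of the source language. -/
inductive STy : Type
  | real : ℕ → STy
  | unit : STy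
  | prod : STy → STy → STy
  | fn : STy → STy → STy

/-- `realⁿ¹ * … * realⁿᵏ`: the unit type for `k = 0`, `realⁿ¹` for `k = 1`, nested to the right. -/
def STy.dom : List ℕ → STy
  | [] => .unit
  | [n] => .real n
  | n :: m :: ns => .prod (.real n) (STy.dom (m :: ns))

/-- Well-typed terms of the source language, up to `α`-equivalence. -/
inductive STm (S : Sig.{u, v}) : List STy → STy → Type u
  | var {Γ : List STy} {τ : STy} : Var Γ τ → STm S Γ τ
  | op {Γ : List STy} {ns : List ℕ} {m : ℕ} :
      S.Op ns m → STm S Γ (STy.dom ns) → STm S Γ (.real m)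
  | unit {Γ : List STy} : STm S Γ .unit
  | pair {Γ : List STy} {τ σ : STy} : STm S Γ τ → STm S Γ σ → STm S Γ (.prod τ σ)
  | fst {Γ : List STy} {τ σ : STy} : STm S Γ (.prod τ σ) → STm S Γ τ
  | snd {Γ : List STy} {τ σ : STy} : STm S Γ (.prod τ σ) → STm S Γ σ
  | lam {Γ : List STy} {τ σ : STy} : STm S (τ :: Γ) σ → STm S Γ (.fn τ σ)
  | app {Γ : List STy} {τ σ : STy} : STm S Γ (.fn τ σ) → STm S Γ τ → STm S Γ σ

namespace STm

variable {S : Sig.{u, v}}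

def ren {Γ : List STy} {τ : STy} (t : STm S Γ τ) {Δ : List STy} (ρ : Ren Γ Δ) : STm S Δ τ :=
  match t with
  | .var a => .var (ρ _ a)
  | .op o t => .op o (t.ren ρ)
  | .unit => .unit
  | .pair t s => .pair (t.ren ρ) (s.ren ρ)
  | .fst t => .fst (t.ren ρ)
  | .snd t => .snd (t.ren ρ)
  | .lam t => .lam (t.ren (ρ.lift _))
  | .app t s => .app (t.ren ρ) (s.ren ρ)

end STm

/-- Parallel substitutions. -/
def SSub (S : Sig.{u, v}) (Γ Δ : List STy) : Type u := ∀ τ : STy, Var Γ τ → STm S Δ τ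

/-- Substitution under a binder. -/
def SSub.lift {S : Sig.{u, v}} {Γ Δ : List STy} (θ : SSub S Γ Δ) (σ : STy) :
    SSub S (σ :: Γ) (σ :: Δ)
  | _, .z => .var .z
  | _, .s a => (θ _ a).ren (Ren.wk Δ σ)

/-- Extension of a substitution by a term for the last variable. -/
def SSub.cons {S : Sig.{u, v}} {Γ Δ : List STy} {σ : STy} (θ : SSub S Γ Δ) (s : STm S Δ σ) :
    SSub S (σ :: Γ) Δ
  | _, .z => s
  | _, .s a => θ _ a

/-- The identity substitution. -/
def SSub.id {S : Sig.{u, v}} (Γ : List STy) : SSub S Γ Γ := fun _ a => .var a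

namespace STm

variable {S : Sig.{u, v}}

/-- Capture-avoiding parallel substitution. -/
def sub {Γ : List STy} {τ : STy} (t : STm S Γ τ) {Δ : List STy} (θ : SSub S Γ Δ) : STm S Δ τ :=
  match t with
  | .var a => θ _ a
  | .op o t => .op o (t.sub θ)
  | .unit => .unit
  | .pair t s => .pair (t.sub θ) (s.sub θ)
  | .fst t => .fst (t.sub θ)
  | .snd t => .snd (t.sub θ)
  | .lam t => .lam (t.sub (θ.lift _))
  | .app t s => .app (t.sub θ) (s.sub θ)

/-- Substitution `t[s/x]` for the last variable. -/
def inst {Γ : List STy} {τ σ : STy} (t : STm S (σ :: Γ) τ) (s : STm S Γ σ) : STm S Γ τ :=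
  t.sub ((SSub.id Γ).cons s)

end STm

/-- The `βη`-equational theory of the source language. -/
inductive SEq {S : Sig.{u, v}} : ∀ {Γ : List STy} {τ : STy}, STm S Γ τ → STm S Γ τ → Prop
  | refl {Γ : List STy} {τ : STy} (t : STm S Γ τ) : SEq t t
  | symm {Γ : List STy} {τ : STy} {t s : STm S Γ τ} : SEq t s → SEq s t
  | trans {Γ : List STy} {τ : STy} {t s r : STm S Γ τ} : SEq t s → SEq s r → SEq t r
  | op {Γ : List STy} {ns : List ℕ} {m : ℕ} (o : S.Op ns m) {t t' : STm S Γ (STy.dom ns)} :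
      SEq t t' → SEq (.op o t) (.op o t')
  | pair {Γ : List STy} {τ σ : STy} {t t' : STm S Γ τ} {s s' : STm S Γ σ} :
      SEq t t' → SEq s s' → SEq (.pair t s) (.pair t' s')
  | fst {Γ : List STy} {τ σ : STy} {t t' : STm S Γ (.prod τ σ)} : SEq t t' → SEq (.fst t) (.fst t')
  | snd {Γ : List STy} {τ σ : STy} {t t' : STm S Γ (.prod τ σ)} : SEq t t' → SEq (.snd t) (.snd t')
  | lam {Γ : List STy} {τ σ : STy} {t t' : STm S (τ :: Γ) σ} : SEq t t' → SEq (.lam t) (.lam t')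
  | app {Γ : List STy} {τ σ : STy} {t t' : STm S Γ (.fn τ σ)} {s s' : STm S Γ τ} :
      SEq t t' → SEq s s' → SEq (.app t s) (.app t' s')
  | unit_eta {Γ : List STy} (t : STm S Γ .unit) : SEq t .unit
  | fst_beta {Γ : List STy} {τ σ : STy} (t : STm S Γ τ) (s : STm S Γ σ) :
      SEq (.fst (.pair t s)) t
  | snd_beta {Γ : List STy} {τ σ : STy} (t : STm S Γ τ) (s : STm S Γ σ) :
      SEq (.snd (.pair t s)) s
  | pair_eta {Γ : List STy} {τ σ : STy} (t : STm S Γ (.prod τ σ)) :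
      SEq t (.pair (.fst t) (.snd t))
  | fn_beta {Γ : List STy} {τ σ : STy} (t : STm S (τ :: Γ) σ) (s : STm S Γ τ) :
      SEq (.app (.lam t) s) (t.inst s)
  | fn_eta {Γ : List STy} {τ σ : STy} (t : STm S Γ (.fn τ σ)) :
      SEq t (.lam (.app (t.ren (Ren.wk Γ τ)) (.var .z)))

namespace STm

variable {S : Sig.{u, v}}

theorem ren_ren {Γ : List STy} {τ : STy} (t : STm S Γ τ) {Δ Θ : List STy} (ρ : Ren Γ Δ)
    (ρ' : Ren Δ Θ) : (t.ren ρ).ren ρ' = t.ren (fun τ a => ρ' τ (ρ τ a)) := by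
  induction t generalizing Δ Θ <;> simp only [ren, Ren.lift_comp, *]

theorem ren_sub {Γ : List STy} {τ : STy} (t : STm S Γ τ) {Δ Θ : List STy} (ρ : Ren Γ Δ)
    (θ : SSub S Δ Θ) : (t.ren ρ).sub θ = t.sub (fun τ a => θ τ (ρ τ a)) := by
  have key : ∀ {Γ Δ Θ : List STy} (ρ : Ren Γ Δ) (θ : SSub S Δ Θ) (σ : STy),
      (fun τ a => θ.lift σ τ (ρ.lift σ τ a)) = SSub.lift (fun τ a => θ τ (ρ τ a)) σ := by
    intro Γ Δ Θ ρ θ σ; funext τ a; cases a <;> rfl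
  induction t generalizing Δ Θ <;> simp only [ren, sub, *]

theorem sub_ren {Γ : List STy} {τ : STy} (t : STm S Γ τ) {Δ Θ : List STy} (θ : SSub S Γ Δ)
    (ρ : Ren Δ Θ) : (t.sub θ).ren ρ = t.sub (fun τ a => (θ τ a).ren ρ) := by
  have key : ∀ {Γ Δ Θ : List STy} (θ : SSub S Γ Δ) (ρ : Ren Δ Θ) (σ : STy),
      (fun τ a => (θ.lift σ τ a).ren (ρ.lift σ)) = SSub.lift (fun τ a => (θ τ a).ren ρ) σ := by
    intro Γ Δ Θ θ ρ σ; funext τ a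
    cases a
    · rfl
    · simp only [SSub.lift, ren_ren]; rfl
  induction t generalizing Δ Θ <;> simp only [ren, sub, *]

theorem sub_sub {Γ : List STy} {τ : STy} (t : STm S Γ τ) {Δ Θ : List STy} (θ : SSub S Γ Δ)
    (θ' : SSub S Δ Θ) : (t.sub θ).sub θ' = t.sub (fun τ a => (θ τ a).sub θ') := by
  have key : ∀ {Γ Δ Θ : List STy} (θ : SSub S Γ Δ) (θ' : SSub S Δ Θ) (σ : STy),
      (fun τ a => (θ.lift σ τ a).sub (θ'.lift σ)) = SSub.lift (fun τ a => (θ τ a).sub θ') σ := by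
    intro Γ Δ Θ θ θ' σ; funext τ a
    cases a
    · rfl
    · simp only [SSub.lift, ren_sub, sub_ren]; rfl
  induction t generalizing Δ Θ <;> simp only [sub, *]

theorem sub_id {Γ : List STy} {τ : STy} (t : STm S Γ τ) : t.sub (SSub.id Γ) = t := by
  have key : ∀ (Γ : List STy) (σ : STy), (SSub.id (S := S) Γ).lift σ = SSub.id (σ :: Γ) := by
    intro Γ σ; funext τ a; cases a <;> rfl
  induction t <;> simp only [sub, *]
  rfl

theorem inst_sub {Γ Δ : List STy} {τ σ : STy} (t : STm S (σ :: Γ) τ) (s : STm S Γ σ)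
    (θ : SSub S Γ Δ) : (t.inst s).sub θ = (t.sub (θ.lift σ)).inst (s.sub θ) := by
  unfold inst
  rw [sub_sub, sub_sub]
  congr 1
  funext τ a
  cases a
  · rfl
  · simp only [SSub.lift, ren_sub]; exact (sub_id _).symm

theorem wk_sub_lift {Γ Δ : List STy} {τ : STy} (t : STm S Γ τ) (θ : SSub S Γ Δ) (σ : STy) :
    (t.ren (Ren.wk Γ σ)).sub (θ.lift σ) = (t.sub θ).ren (Ren.wk Δ σ) := by
  rw [ren_sub, sub_ren]; rfl

theorem ren_eq_sub {Γ Δ : List STy} {τ : STy} (t : STm S Γ τ) (ρ : Ren Γ Δ) :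
    t.ren ρ = t.sub (fun _ a => .var (ρ _ a)) := by
  conv_lhs => rw [← sub_id (t.ren ρ), ren_sub]
  rfl

end STm

theorem SEq.sub {S : Sig.{u, v}} {Γ : List STy} {τ : STy} {t t' : STm S Γ τ} (h : SEq t t')
    {Δ : List STy} (θ : SSub S Γ Δ) : SEq (t.sub θ) (t'.sub θ) := by
  induction h generalizing Δ with
  | refl t => exact .refl _
  | symm _ ih => exact .symm (ih θ)
  | trans _ _ ih ih' => exact .trans (ih θ) (ih' θ)
  | op o _ ih => exact .op o (ih θ)
  | pair _ _ ih ih' => exact .pair (ih θ) (ih' θ)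
  | fst _ ih => exact .fst (ih θ)
  | snd _ ih => exact .snd (ih θ)
  | lam _ ih => exact .lam (ih _)
  | app _ _ ih ih' => exact .app (ih θ) (ih' θ)
  | unit_eta t => exact .unit_eta _
  | fst_beta t s => exact .fst_beta _ _
  | snd_beta t s => exact .snd_beta _ _
  | pair_eta t => exact .pair_eta _
  | fn_beta t s => rw [STm.inst_sub]; exact .fn_beta _ _
  | fn_eta t =>
    simp only [STm.sub, STm.wk_sub_lift]
    exact .fn_eta _

theorem SEq.sub_right {S : Sig.{u, v}} {Γ : List STy} {τ : STy} (t : STm S Γ τ)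
    {Δ : List STy} {θ θ' : SSub S Γ Δ} (h : ∀ τ a, SEq (θ τ a) (θ' τ a)) :
    SEq (t.sub θ) (t.sub θ') := by
  induction t generalizing Δ with
  | var a => exact h _ a
  | op o t ih => exact .op o (ih h)
  | unit => exact .refl _
  | pair t s ih ih' => exact .pair (ih h) (ih' h)
  | fst t ih => exact .fst (ih h)
  | snd t ih => exact .snd (ih h)
  | lam t ih =>
    refine .lam (ih ?_)
    intro τ a
    cases a with
    | z => exact .refl _
    | s a => simp only [SSub.lift, STm.ren_eq_sub]; exact (h _ a).sub _
  | app t s ih ih' => exact .app (ih h) (ih' h)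

/-- Programs `x : τ ⊢ t : σ` up to `βη`-equality. -/
instance STm.setoid (S : Sig.{u, v}) (Γ : List STy) (τ : STy) : Setoid (STm S Γ τ) :=
  ⟨SEq, ⟨.refl, .symm, .trans⟩⟩

/-- The substitution of a term for the only variable of a context. -/
def SSub.single {S : Sig.{u, v}} {Γ : List STy} {σ : STy} (t : STm S Γ σ) : SSub S [σ] Γ
  | _, .z => t
  | _, .s a => a.elim

theorem SSub.single_sub {S : Sig.{u, v}} {Γ Δ : List STy} {σ : STy} (t : STm S Γ σ)
    (θ : SSub S Γ Δ) :
    (fun ρ a => (SSub.single t ρ a).sub θ) = SSub.single (t.sub θ) := by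
  funext ρ a
  rcases a with _ | a
  · rfl
  · exact a.elim

theorem SSub.single_var {S : Sig.{u, v}} (τ : STy) :
    SSub.single (.var .z) = SSub.id (S := S) [τ] := by
  funext ρ a
  rcases a with _ | a
  · rfl
  · exact a.elim

theorem SEq.single {S : Sig.{u, v}} {Γ : List STy} {σ : STy} {t t' : STm S Γ σ} (h : SEq t t') :
    ∀ ρ a, SEq (SSub.single t ρ a) (SSub.single t' ρ a) := by
  intro ρ a
  rcases a with _ | a
  · exact h
  · exact a.elim

/-- Programs `x : τ ⊢ t : σ` up to `βη`-equality. -/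
def SHom (S : Sig.{u, v}) (τ σ : STy) : Type u := Quotient (STm.setoid S [τ] σ)

namespace SHom

variable {S : Sig.{u, v}}

/-- The class of a program. -/
def mk {τ σ : STy} (t : STm S [τ] σ) : SHom S τ σ := Quotient.mk (STm.setoid S [τ] σ) t

/-- Identities are variables. -/
def id (τ : STy) : SHom S τ τ := mk (.var .z)

/-- Composition `f; g` is substitution of `f` in `g`. -/
def comp {τ σ ρ : STy} (f : SHom S τ σ) (g : SHom S σ ρ) : SHom S τ ρ :=
  Quotient.map₂ (fun (t : STm S [τ] σ) (s : STm S [σ] ρ) => s.sub (SSub.single t))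
    (fun _ _ h _ _ h' => (SEq.sub h' _).trans (SEq.sub_right _ (SEq.single h))) f g

theorem id_comp {τ σ : STy} (f : SHom S τ σ) : comp (id τ) f = f := by
  rcases f with ⟨t⟩
  exact congrArg mk ((congrArg t.sub (SSub.single_var τ)).trans (STm.sub_id t))

theorem comp_id {τ σ : STy} (f : SHom S τ σ) : comp f (id σ) = f := by
  rcases f with ⟨t⟩
  rfl

theorem assoc {τ σ ρ π : STy} (f : SHom S τ σ) (g : SHom S σ ρ) (h : SHom S ρ π) :
    comp (comp f g) h = comp f (comp g h) := by
  rcases f with ⟨t⟩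
  rcases g with ⟨s⟩
  rcases h with ⟨r⟩
  refine congrArg mk (?_ : r.sub _ = (r.sub _).sub _)
  rw [STm.sub_sub, SSub.single_sub]

end SHom

/-- The syntactic category of the source language: objects are types, and morphisms are programs
`x : τ ⊢ t : σ` up to `βη`-equality. -/
structure Syn (S : Sig.{u, v}) : Type where
  ty : STy

instance (S : Sig.{u, v}) : Category.{u} (Syn S) where
  Hom τ σ := SHom S τ.ty σ.ty
  id τ := SHom.id τ.ty
  comp f g := SHom.comp f g
  id_comp f := SHom.id_comp f
  comp_id f := SHom.comp_id f
  assoc f g h := SHom.assoc f g h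

/-- The morphism of `Syn` represented by a program. -/
def Syn.homMk {S : Sig.{u, v}} {τ σ : STy} (t : STm S [τ] σ) : (⟨τ⟩ : Syn S) ⟶ ⟨σ⟩ := SHom.mk t

/-! ## Cartesian closed structures -/

/-- The operations of a category with chosen terminal object `one`, binary products `prod A B`
and exponentials `exp A B` (written `A ⇒ B` on paper). -/
class CCOps (C : Type u₁) [Category.{v₁} C] where
  one : C
  prod : C → C → C
  exp : C → C → C
  bang (A : C) : A ⟶ one
  fst (A B : C) : prod A B ⟶ A
  snd (A B : C) : prod A B ⟶ B
  pair {X A B : C} : (X ⟶ A) → (X ⟶ B) → (X ⟶ prod A B)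
  ev (A B : C) : prod (exp A B) A ⟶ B
  curry {A B X : C} : (prod A B ⟶ X) → (A ⟶ exp B X)

open CCOps

/-- The equations of a Cartesian closed category: the chosen operations of `C` make `one` a terminal
object, `prod A B` a product and `exp A B` an exponential. -/
structure IsCartesianClosed (C : Type u₁) [Category.{v₁} C] [CCOps C] : Prop where
  bang_uniq {A : C} (f : A ⟶ one) : f = bang A
  pair_fst {X A B : C} (f : X ⟶ A) (g : X ⟶ B) : pair f g ≫ fst A B = f
  pair_snd {X A B : C} (f : X ⟶ A) (g : X ⟶ B) : pair f g ≫ snd A B = g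
  pair_uniq {X A B : C} (h : X ⟶ prod A B) : pair (h ≫ fst A B) (h ≫ snd A B) = h
  curry_ev {A B X : C} (f : prod A B ⟶ X) :
    pair (fst A B ≫ curry f) (snd A B) ≫ ev B X = f
  curry_uniq {A B X : C} (g : A ⟶ exp B X) :
    curry (pair (fst A B ≫ g) (snd A B) ≫ ev B X) = g

/-- A Cartesian closed functor: it preserves the chosen terminal object, products and exponentials,
with their projections and evaluations, on the nose. -/
structure IsCartesianClosedFunctor {C : Type u₁} [Category.{v₁} C] [CCOps C]
    {D : Type u₂} [Category.{v₂} D] [CCOps D] (F : C ⥤ D) : Prop where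
  obj_one : F.obj one = one
  obj_prod (A B : C) : F.obj (prod A B) = prod (F.obj A) (F.obj B)
  obj_exp (A B : C) : F.obj (exp A B) = exp (F.obj A) (F.obj B)
  map_fst (A B : C) : F.map (fst A B) ≍ fst (F.obj A) (F.obj B)
  map_snd (A B : C) : F.map (snd A B) ≍ snd (F.obj A) (F.obj B)
  map_ev (A B : C) : F.map (ev A B) ≍ ev (F.obj A) (F.obj B)

namespace SHom

variable {S : Sig.{u, v}}

def pair {ρ τ σ : STy} (f : SHom S ρ τ) (g : SHom S ρ σ) : SHom S ρ (.prod τ σ) :=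
  Quotient.map₂ (fun (t : STm S [ρ] τ) (s : STm S [ρ] σ) => STm.pair t s)
    (fun _ _ h _ _ h' => SEq.pair h h') f g

/-- `x : τ ⊢ λ y. t[⟨x, y⟩/z]` for `z : τ * σ ⊢ t`. -/
def curry {τ σ ρ : STy} (f : SHom S (.prod τ σ) ρ) : SHom S τ (.fn σ ρ) :=
  Quotient.map (fun t : STm S [.prod τ σ] ρ =>
      STm.lam (t.sub (SSub.single (.pair (.var (.s .z)) (.var .z)))))
    (fun _ _ h => SEq.lam (SEq.sub h _)) f

end SHom

instance (S : Sig.{u, v}) : CCOps (Syn S) where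
  one := ⟨.unit⟩
  prod τ σ := ⟨.prod τ.ty σ.ty⟩
  exp τ σ := ⟨.fn τ.ty σ.ty⟩
  bang _ := Syn.homMk .unit
  fst _ _ := Syn.homMk (.fst (.var .z))
  snd _ _ := Syn.homMk (.snd (.var .z))
  pair f g := SHom.pair f g
  ev _ _ := Syn.homMk (.app (.fst (.var .z)) (.snd (.var .z)))
  curry f := SHom.curry f

/-! ## Locally indexed categories and their total categories -/

/-- A locally indexed category `L : Cᵒᵖ → Cat`: the categories `L A`, for `A` in `C`, have the same
objects, and the change of base functors `L f : L B → L A`, for `f : A ⟶ B`, are the identity on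
objects. -/
structure LocallyIndexed (C : Type u₁) [Category.{v₁} C] where
  Obj : Type u₂
  Hom : C → Obj → Obj → Type v₂
  id (A : C) (X : Obj) : Hom A X X
  comp {A : C} {X Y Z : Obj} : Hom A X Y → Hom A Y Z → Hom A X Z
  map {A B : C} (f : A ⟶ B) {X Y : Obj} : Hom B X Y → Hom A X Y
  id_comp {A : C} {X Y : Obj} (a : Hom A X Y) : comp (id A X) a = a
  comp_id {A : C} {X Y : Obj} (a : Hom A X Y) : comp a (id A Y) = a
  assoc {A : C} {X Y Z W : Obj} (a : Hom A X Y) (b : Hom A Y Z) (c : Hom A Z W) :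
    comp (comp a b) c = comp a (comp b c)
  map_id {A B : C} (f : A ⟶ B) (X : Obj) : map f (id B X) = id A X
  map_comp {A B : C} (f : A ⟶ B) {X Y Z : Obj} (a : Hom B X Y) (b : Hom B Y Z) :
    map f (comp a b) = comp (map f a) (map f b)
  id_map {A : C} {X Y : Obj} (a : Hom A X Y) : map (𝟙 A) a = a
  comp_map {A B D : C} (f : A ⟶ B) (g : B ⟶ D) {X Y : Obj} (a : Hom D X Y) :
    map (f ≫ g) a = map f (map g a)

/-- Objects of `Σ_C L`. -/
structure Total {C : Type u₁} [Category.{v₁} C] (L : LocallyIndexed.{u₁, v₁, u₂, v₂} C) where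
  base : C
  fib : L.Obj

/-- Morphisms of `Σ_C L`. -/
@[ext]
structure Total.Hom {C : Type u₁} [Category.{v₁} C] {L : LocallyIndexed.{u₁, v₁, u₂, v₂} C}
    (A B : Total L) where
  base : A.base ⟶ B.base
  fib : L.Hom A.base A.fib B.fib

/-- The category `Σ_C L`. -/
instance {C : Type u₁} [Category.{v₁} C] (L : LocallyIndexed.{u₁, v₁, u₂, v₂} C) :
    Category (Total L) where
  Hom A B := Total.Hom A B
  id A := ⟨𝟙 A.base, L.id A.base A.fib⟩
  comp f g := ⟨f.base ≫ g.base, L.comp f.fib (L.map f.base g.fib)⟩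
  id_comp f := Total.Hom.ext (Category.id_comp _) (by simp [L.id_map, L.id_comp])
  comp_id f := Total.Hom.ext (Category.comp_id _) (by simp [L.map_id, L.comp_id])
  assoc f g h := Total.Hom.ext (Category.assoc _ _ _)
    (by simp [L.comp_map, L.map_comp, L.assoc])

/-- Objects of `Σ_C Lᵒᵖ`. -/
structure TotalOp {C : Type u₁} [Category.{v₁} C] (L : LocallyIndexed.{u₁, v₁, u₂, v₂} C) where
  base : C
  fib : L.Obj

/-- Morphisms of `Σ_C Lᵒᵖ`. -/
@[ext]
structure TotalOp.Hom {C : Type u₁} [Category.{v₁} C] {L : LocallyIndexed.{u₁, v₁, u₂, v₂} C}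
    (A B : TotalOp L) where
  base : A.base ⟶ B.base
  fib : L.Hom A.base B.fib A.fib

/-- The category `Σ_C Lᵒᵖ`. -/
instance {C : Type u₁} [Category.{v₁} C] (L : LocallyIndexed.{u₁, v₁, u₂, v₂} C) :
    Category (TotalOp L) where
  Hom A B := TotalOp.Hom A B
  id A := ⟨𝟙 A.base, L.id A.base A.fib⟩
  comp f g := ⟨f.base ≫ g.base, L.comp (L.map f.base g.fib) f.fib⟩
  id_comp f := TotalOp.Hom.ext (Category.id_comp _) (by simp [L.id_map, L.comp_id])
  comp_id f := TotalOp.Hom.ext (Category.comp_id _) (by simp [L.map_id, L.id_comp])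
  assoc f g h := TotalOp.Hom.ext (Category.assoc _ _ _)
    (by simp [L.comp_map, L.map_comp, L.assoc])

/-- The operations of a categorical model of the linear language: biproducts (with the sum of
parallel morphisms); `⇒`-types `fn B Y`, with `psi : L(A × B)(X, Y) ≅ L(A)(X, B ⇒ Y)`;
`!(-) ⊗ (-)`-types `tens B X`, with `phi : L(A)(!B ⊗ X, Y) ≅ L(A × B)(X, Y)`; and Cartesian
`⊸`-types `lolli X Y`, with `lam : L(A)(X, Y) ≅ C(A, X ⊸ Y)`. Only the operations are recorded, as
the laws are not needed to define the operations of the total categories. -/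
class LinOps {C : Type u₁} [Category.{v₁} C] [CCOps C]
    (L : LocallyIndexed.{u₁, v₁, u₂, v₂} C) where
  one : L.Obj
  prod : L.Obj → L.Obj → L.Obj
  fn : C → L.Obj → L.Obj
  tens : C → L.Obj → L.Obj
  lolli : L.Obj → L.Obj → C
  bang (A : C) (X : L.Obj) : L.Hom A X one
  fst (A : C) (X Y : L.Obj) : L.Hom A (prod X Y) X
  snd (A : C) (X Y : L.Obj) : L.Hom A (prod X Y) Y
  pair {A : C} {X Y Z : L.Obj} : L.Hom A Z X → L.Hom A Z Y → L.Hom A Z (prod X Y)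
  zero (A : C) (X Y : L.Obj) : L.Hom A X Y
  add {A : C} {X Y : L.Obj} : L.Hom A X Y → L.Hom A X Y → L.Hom A X Y
  psi {A B : C} {X Y : L.Obj} : L.Hom (CCOps.prod A B) X Y → L.Hom A X (fn B Y)
  psiInv {A B : C} {X Y : L.Obj} : L.Hom A X (fn B Y) → L.Hom (CCOps.prod A B) X Y
  phi {A B : C} {X Y : L.Obj} : L.Hom A (tens B X) Y → L.Hom (CCOps.prod A B) X Y
  phiInv {A B : C} {X Y : L.Obj} : L.Hom (CCOps.prod A B) X Y → L.Hom A (tens B X) Y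
  lam {A : C} {X Y : L.Obj} : L.Hom A X Y → (A ⟶ lolli X Y)
  lamInv {A : C} {X Y : L.Obj} : (A ⟶ lolli X Y) → L.Hom A X Y

section TotalOps

variable {C : Type u₁} [Category.{v₁} C] [CCOps C] (L : LocallyIndexed.{u₁, v₁, u₂, v₂} C)
  [LinOps L]

/-- The Cartesian closed structure of `Σ_C L`, with
`(A₁, A₂) ⇒ (B₁, B₂) = (A₁ ⇒ (B₁ × (A₂ ⊸ B₂)), A₁ ⇒ B₂)`. -/
instance : CCOps (Total L) where
  one := ⟨one, LinOps.one⟩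
  prod A B := ⟨prod A.base B.base, LinOps.prod A.fib B.fib⟩
  exp A B := ⟨exp A.base (prod B.base (LinOps.lolli A.fib B.fib)), LinOps.fn A.base B.fib⟩
  bang A := ⟨bang A.base, LinOps.bang A.base A.fib⟩
  fst A B := ⟨fst A.base B.base, LinOps.fst _ A.fib B.fib⟩
  snd A B := ⟨snd A.base B.base, LinOps.snd _ A.fib B.fib⟩
  pair f g := ⟨pair f.base g.base, LinOps.pair f.fib g.fib⟩
  ev A B :=
    ⟨ev A.base _ ≫ fst B.base _,
     LinOps.add
      (L.comp (LinOps.fst _ (LinOps.fn A.base B.fib) A.fib)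
        (L.map (pair (𝟙 _) (snd _ A.base)) (LinOps.psiInv (L.id _ (LinOps.fn A.base B.fib)))))
      (L.comp (LinOps.snd _ (LinOps.fn A.base B.fib) A.fib)
        (LinOps.lamInv (ev A.base _ ≫ snd B.base _)))⟩
  curry {A B _} f :=
    ⟨curry (pair f.base (LinOps.lam (L.comp (LinOps.pair (LinOps.zero _ B.fib A.fib) (L.id _ B.fib))
        f.fib))),
     LinOps.psi (L.comp (LinOps.pair (L.id _ A.fib) (LinOps.zero _ A.fib B.fib)) f.fib)⟩

/-- The Cartesian closed structure of `Σ_C Lᵒᵖ`, with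
`(A₁, A₂) ⇒ (B₁, B₂) = (A₁ ⇒ (B₁ × (B₂ ⊸ A₂)), !A₁ ⊗ B₂)`. -/
instance : CCOps (TotalOp L) where
  one := ⟨one, LinOps.one⟩
  prod A B := ⟨prod A.base B.base, LinOps.prod A.fib B.fib⟩
  exp A B := ⟨exp A.base (prod B.base (LinOps.lolli B.fib A.fib)), LinOps.tens A.base B.fib⟩
  bang A := ⟨bang A.base, LinOps.zero A.base LinOps.one A.fib⟩
  fst A B := ⟨fst A.base B.base, LinOps.pair (L.id _ A.fib) (LinOps.zero _ A.fib B.fib)⟩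
  snd A B := ⟨snd A.base B.base, LinOps.pair (LinOps.zero _ B.fib A.fib) (L.id _ B.fib)⟩
  pair {_ A B} f g :=
    ⟨pair f.base g.base,
     LinOps.add (L.comp (LinOps.fst _ A.fib B.fib) f.fib) (L.comp (LinOps.snd _ A.fib B.fib) g.fib)⟩
  ev A B :=
    ⟨ev A.base _ ≫ fst B.base _,
     LinOps.pair
      (L.map (pair (𝟙 _) (snd _ A.base)) (LinOps.phi (L.id _ (LinOps.tens A.base B.fib))))
      (LinOps.lamInv (ev A.base _ ≫ snd B.base _))⟩
  curry {A B _} f :=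
    ⟨curry (pair f.base (LinOps.lam (L.comp f.fib (LinOps.snd _ A.fib B.fib)))),
     LinOps.phiInv (L.comp f.fib (LinOps.fst _ A.fib B.fib))⟩

end TotalOps

/-! ## The target language -/

mutual

/-- Cartesian types of the target language. -/
inductive CTy : Type
  | real : ℕ → CTy
  | unit : CTy
  | prod : CTy → CTy → CTy
  | fn : CTy → CTy → CTy
  | lolli : LTy → LTy → CTy

/-- Linear types of the target language; `tens τ σ` is `!τ ⊗ σ`. -/
inductive LTy : Type
  | real : ℕ → LTy
  | unit : LTy
  | prod : LTy → LTy → LTy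
  | fn : CTy → LTy → LTy
  | tens : CTy → LTy → LTy

end

/-- The Cartesian type `realⁿ¹ * … * realⁿᵏ`, bracketed as in the source language. -/
def CTy.dom : List ℕ → CTy
  | [] => .unit
  | [n] => .real n
  | n :: m :: ns => .prod (.real n) (CTy.dom (m :: ns))

/-- The linear type `realⁿ¹ * … * realⁿᵏ`. -/
def LTy.dom : List ℕ → LTy
  | [] => .unit
  | [n] => .real n
  | n :: m :: ns => .prod (.real n) (LTy.dom (m :: ns))

/-- The part of a judgement to the right of the Cartesian context: `cart τ` stands for `Γ ⊢ - : τ`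
and `lin υ σ` stands for `Γ; x : υ ⊢ - : σ`. -/
inductive Jdg : Type
  | cart : CTy → Jdg
  | lin : LTy → LTy → Jdg

/-- Replacing the type of the linear variable, if there is one. -/
def Jdg.reroot (π : LTy) : Jdg → Jdg
  | .cart τ => .cart τ
  | .lin _ σ => .lin π σ

/-- Well-typed terms of the target language, up to `α`-equivalence. Besides the terms of the source
language, there are abstraction `llam` and application `lapp` for `⊸`, the linear variable `lvar`,
linear operations `lop`, tuples and projections `lunit`, `lpair`, `lfst`, `lsnd` of linear type,
abstraction `lfun` and application `lfunApp` for `τ ⇒ σ` with `σ` linear, `tens t s` for `!t ⊗ s`,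
`tensCase t s` for `case t of !y ⊗ z → s`, and the monoid structure `zero`, `add`. -/
inductive Tm (S : Sig.{u, v}) : List CTy → Jdg → Type (max u v)
  | var {Γ : List CTy} {τ : CTy} : Var Γ τ → Tm S Γ (.cart τ)
  | op {Γ : List CTy} {ns : List ℕ} {m : ℕ} :
      S.Op ns m → Tm S Γ (.cart (CTy.dom ns)) → Tm S Γ (.cart (.real m))
  | unit {Γ : List CTy} : Tm S Γ (.cart .unit)
  | pair {Γ : List CTy} {τ σ : CTy} :
      Tm S Γ (.cart τ) → Tm S Γ (.cart σ) → Tm S Γ (.cart (.prod τ σ))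
  | fst {Γ : List CTy} {τ σ : CTy} : Tm S Γ (.cart (.prod τ σ)) → Tm S Γ (.cart τ)
  | snd {Γ : List CTy} {τ σ : CTy} : Tm S Γ (.cart (.prod τ σ)) → Tm S Γ (.cart σ)
  | lam {Γ : List CTy} {τ σ : CTy} : Tm S (τ :: Γ) (.cart σ) → Tm S Γ (.cart (.fn τ σ))
  | app {Γ : List CTy} {τ σ : CTy} :
      Tm S Γ (.cart (.fn τ σ)) → Tm S Γ (.cart τ) → Tm S Γ (.cart σ)
  | llam {Γ : List CTy} {υ σ : LTy} : Tm S Γ (.lin υ σ) → Tm S Γ (.cart (.lolli υ σ))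
  | lvar {Γ : List CTy} {υ : LTy} : Tm S Γ (.lin υ υ)
  | lop {Γ : List CTy} {υ : LTy} {ns ns' : List ℕ} {m : ℕ} :
      S.LOp ns ns' m → Tm S Γ (.cart (CTy.dom ns)) → Tm S Γ (.lin υ (LTy.dom ns')) →
        Tm S Γ (.lin υ (.real m))
  | lunit {Γ : List CTy} {υ : LTy} : Tm S Γ (.lin υ .unit)
  | lpair {Γ : List CTy} {υ σ ρ : LTy} :
      Tm S Γ (.lin υ σ) → Tm S Γ (.lin υ ρ) → Tm S Γ (.lin υ (.prod σ ρ))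
  | lfst {Γ : List CTy} {υ σ ρ : LTy} : Tm S Γ (.lin υ (.prod σ ρ)) → Tm S Γ (.lin υ σ)
  | lsnd {Γ : List CTy} {υ σ ρ : LTy} : Tm S Γ (.lin υ (.prod σ ρ)) → Tm S Γ (.lin υ ρ)
  | lfun {Γ : List CTy} {υ σ : LTy} {τ : CTy} :
      Tm S (τ :: Γ) (.lin υ σ) → Tm S Γ (.lin υ (.fn τ σ))
  | lfunApp {Γ : List CTy} {υ σ : LTy} {τ : CTy} :
      Tm S Γ (.lin υ (.fn τ σ)) → Tm S Γ (.cart τ) → Tm S Γ (.lin υ σ)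
  | tens {Γ : List CTy} {υ σ : LTy} {τ : CTy} :
      Tm S Γ (.cart τ) → Tm S Γ (.lin υ σ) → Tm S Γ (.lin υ (.tens τ σ))
  | tensCase {Γ : List CTy} {υ σ ρ : LTy} {τ : CTy} :
      Tm S Γ (.lin υ (.tens τ σ)) → Tm S (τ :: Γ) (.lin σ ρ) → Tm S Γ (.lin υ ρ)
  | lapp {Γ : List CTy} {υ σ ρ : LTy} :
      Tm S Γ (.cart (.lolli σ ρ)) → Tm S Γ (.lin υ σ) → Tm S Γ (.lin υ ρ)
  | zero {Γ : List CTy} {υ σ : LTy} : Tm S Γ (.lin υ σ)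
  | add {Γ : List CTy} {υ σ : LTy} :
      Tm S Γ (.lin υ σ) → Tm S Γ (.lin υ σ) → Tm S Γ (.lin υ σ)

namespace Tm

variable {S : Sig.{u, v}}

def ren {Γ : List CTy} {j : Jdg} (t : Tm S Γ j) {Δ : List CTy} (ρ : Ren Γ Δ) : Tm S Δ j :=
  match t with
  | .var a => .var (ρ _ a)
  | .op o t => .op o (t.ren ρ)
  | .unit => .unit
  | .pair t s => .pair (t.ren ρ) (s.ren ρ)
  | .fst t => .fst (t.ren ρ)
  | .snd t => .snd (t.ren ρ)
  | .lam t => .lam (t.ren (ρ.lift _))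
  | .app t s => .app (t.ren ρ) (s.ren ρ)
  | .llam t => .llam (t.ren ρ)
  | .lvar => .lvar
  | .lop o t s => .lop o (t.ren ρ) (s.ren ρ)
  | .lunit => .lunit
  | .lpair t s => .lpair (t.ren ρ) (s.ren ρ)
  | .lfst t => .lfst (t.ren ρ)
  | .lsnd t => .lsnd (t.ren ρ)
  | .lfun t => .lfun (t.ren (ρ.lift _))
  | .lfunApp t s => .lfunApp (t.ren ρ) (s.ren ρ)
  | .tens t s => .tens (t.ren ρ) (s.ren ρ)
  | .tensCase t s => .tensCase (t.ren ρ) (s.ren (ρ.lift _))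
  | .lapp t s => .lapp (t.ren ρ) (s.ren ρ)
  | .zero => .zero
  | .add t s => .add (t.ren ρ) (s.ren ρ)

end Tm

/-- Parallel substitutions for the Cartesian variables. -/
def Sub (S : Sig.{u, v}) (Γ Δ : List CTy) : Type (max u v) :=
  ∀ τ : CTy, Var Γ τ → Tm S Δ (.cart τ)

/-- Substitution under a binder. -/
def Sub.lift {S : Sig.{u, v}} {Γ Δ : List CTy} (θ : Sub S Γ Δ) (σ : CTy) :
    Sub S (σ :: Γ) (σ :: Δ)
  | _, .z => .var .z
  | _, .s a => (θ _ a).ren (Ren.wk Δ σ)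

/-- Extension of a substitution by a term for the last variable. -/
def Sub.cons {S : Sig.{u, v}} {Γ Δ : List CTy} {σ : CTy} (θ : Sub S Γ Δ) (s : Tm S Δ (.cart σ)) :
    Sub S (σ :: Γ) Δ
  | _, .z => s
  | _, .s a => θ _ a

/-- The identity substitution. -/
def Sub.id {S : Sig.{u, v}} (Γ : List CTy) : Sub S Γ Γ := fun _ a => .var a

namespace Tm

variable {S : Sig.{u, v}}

/-- Capture-avoiding parallel substitution for the Cartesian variables. -/
def sub {Γ : List CTy} {j : Jdg} (t : Tm S Γ j) {Δ : List CTy} (θ : Sub S Γ Δ) : Tm S Δ j :=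
  match t with
  | .var a => θ _ a
  | .op o t => .op o (t.sub θ)
  | .unit => .unit
  | .pair t s => .pair (t.sub θ) (s.sub θ)
  | .fst t => .fst (t.sub θ)
  | .snd t => .snd (t.sub θ)
  | .lam t => .lam (t.sub (θ.lift _))
  | .app t s => .app (t.sub θ) (s.sub θ)
  | .llam t => .llam (t.sub θ)
  | .lvar => .lvar
  | .lop o t s => .lop o (t.sub θ) (s.sub θ)
  | .lunit => .lunit
  | .lpair t s => .lpair (t.sub θ) (s.sub θ)
  | .lfst t => .lfst (t.sub θ)
  | .lsnd t => .lsnd (t.sub θ)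
  | .lfun t => .lfun (t.sub (θ.lift _))
  | .lfunApp t s => .lfunApp (t.sub θ) (s.sub θ)
  | .tens t s => .tens (t.sub θ) (s.sub θ)
  | .tensCase t s => .tensCase (t.sub θ) (s.sub (θ.lift _))
  | .lapp t s => .lapp (t.sub θ) (s.sub θ)
  | .zero => .zero
  | .add t s => .add (t.sub θ) (s.sub θ)

/-- Substitution `t[s/y]` for the last Cartesian variable. -/
def inst {Γ : List CTy} {j : Jdg} {σ : CTy} (t : Tm S (σ :: Γ) j) (s : Tm S Γ (.cart σ)) :
    Tm S Γ j :=
  t.sub ((Sub.id Γ).cons s)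

/-- What may be substituted for the linear variable, if there is one. -/
def LinArg (S : Sig.{u, v}) (Γ : List CTy) (π : LTy) : Jdg → Type (max u v)
  | .cart _ => PUnit
  | .lin υ _ => Tm S Γ (.lin π υ)

/-- Capture-avoiding substitution for the linear variable, if there is one. -/
def lsubAux {Γ : List CTy} {j : Jdg} (t : Tm S Γ j) {π : LTy} (a : LinArg S Γ π j) :
    Tm S Γ (j.reroot π) :=
  match t, a with
  | .var b, _ => .var b
  | .op o t, _ => .op o t
  | .unit, _ => .unit
  | .pair t s, _ => .pair t s
  | .fst t, _ => .fst t
  | .snd t, _ => .snd t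
  | .lam t, _ => .lam t
  | .app t s, _ => .app t s
  | .llam t, _ => .llam t
  | .lvar, a => a
  | .lop o t s, a => .lop o t (s.lsubAux a)
  | .lunit, _ => .lunit
  | .lpair t s, a => .lpair (t.lsubAux a) (s.lsubAux a)
  | .lfst t, a => .lfst (t.lsubAux a)
  | .lsnd t, a => .lsnd (t.lsubAux a)
  | .lfun t, a => .lfun (t.lsubAux (Tm.ren a (Ren.wk _ _)))
  | .lfunApp t s, a => .lfunApp (t.lsubAux a) s
  | .tens t s, a => .tens t (s.lsubAux a)
  | .tensCase t s, a => .tensCase (t.lsubAux a) s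
  | .lapp t s, a => .lapp t (s.lsubAux a)
  | .zero, _ => .zero
  | .add t s, a => .add (t.lsubAux a) (s.lsubAux a)

/-- Substitution `t[s/x]` for the linear variable. -/
def lsub {Γ : List CTy} {π υ σ : LTy} (t : Tm S Γ (.lin υ σ)) (s : Tm S Γ (.lin π υ)) :
    Tm S Γ (.lin π σ) :=
  t.lsubAux (j := .lin υ σ) s

end Tm

/-- The `βη+`-equational theory of the target language. -/
inductive TEq {S : Sig.{u, v}} : ∀ {Γ : List CTy} {j : Jdg}, Tm S Γ j → Tm S Γ j → Prop
  | refl {Γ : List CTy} {j : Jdg} (t : Tm S Γ j) : TEq t t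
  | symm {Γ : List CTy} {j : Jdg} {t s : Tm S Γ j} : TEq t s → TEq s t
  | trans {Γ : List CTy} {j : Jdg} {t s r : Tm S Γ j} : TEq t s → TEq s r → TEq t r
  -- congruence
  | op {Γ : List CTy} {ns : List ℕ} {m : ℕ} (o : S.Op ns m) {t t' : Tm S Γ (.cart (CTy.dom ns))} :
      TEq t t' → TEq (.op o t) (.op o t')
  | pair {Γ : List CTy} {τ σ : CTy} {t t' : Tm S Γ (.cart τ)} {s s' : Tm S Γ (.cart σ)} :
      TEq t t' → TEq s s' → TEq (.pair t s) (.pair t' s')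
  | fst {Γ : List CTy} {τ σ : CTy} {t t' : Tm S Γ (.cart (.prod τ σ))} :
      TEq t t' → TEq (.fst t) (.fst t')
  | snd {Γ : List CTy} {τ σ : CTy} {t t' : Tm S Γ (.cart (.prod τ σ))} :
      TEq t t' → TEq (.snd t) (.snd t')
  | lam {Γ : List CTy} {τ σ : CTy} {t t' : Tm S (τ :: Γ) (.cart σ)} :
      TEq t t' → TEq (.lam t) (.lam t')
  | app {Γ : List CTy} {τ σ : CTy} {t t' : Tm S Γ (.cart (.fn τ σ))} {s s' : Tm S Γ (.cart τ)} :
      TEq t t' → TEq s s' → TEq (.app t s) (.app t' s')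
  | llam {Γ : List CTy} {υ σ : LTy} {t t' : Tm S Γ (.lin υ σ)} :
      TEq t t' → TEq (.llam t) (.llam t')
  | lop {Γ : List CTy} {υ : LTy} {ns ns' : List ℕ} {m : ℕ} (o : S.LOp ns ns' m)
      {t t' : Tm S Γ (.cart (CTy.dom ns))} {s s' : Tm S Γ (.lin υ (LTy.dom ns'))} :
      TEq t t' → TEq s s' → TEq (.lop o t s) (.lop o t' s')
  | lpair {Γ : List CTy} {υ σ ρ : LTy} {t t' : Tm S Γ (.lin υ σ)} {s s' : Tm S Γ (.lin υ ρ)} :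
      TEq t t' → TEq s s' → TEq (.lpair t s) (.lpair t' s')
  | lfst {Γ : List CTy} {υ σ ρ : LTy} {t t' : Tm S Γ (.lin υ (.prod σ ρ))} :
      TEq t t' → TEq (.lfst t) (.lfst t')
  | lsnd {Γ : List CTy} {υ σ ρ : LTy} {t t' : Tm S Γ (.lin υ (.prod σ ρ))} :
      TEq t t' → TEq (.lsnd t) (.lsnd t')
  | lfun {Γ : List CTy} {υ σ : LTy} {τ : CTy} {t t' : Tm S (τ :: Γ) (.lin υ σ)} :
      TEq t t' → TEq (.lfun t) (.lfun t')
  | lfunApp {Γ : List CTy} {υ σ : LTy} {τ : CTy} {t t' : Tm S Γ (.lin υ (.fn τ σ))}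
      {s s' : Tm S Γ (.cart τ)} : TEq t t' → TEq s s' → TEq (.lfunApp t s) (.lfunApp t' s')
  | tens {Γ : List CTy} {υ σ : LTy} {τ : CTy} {t t' : Tm S Γ (.cart τ)}
      {s s' : Tm S Γ (.lin υ σ)} : TEq t t' → TEq s s' → TEq (.tens t s) (.tens t' s')
  | tensCase {Γ : List CTy} {υ σ ρ : LTy} {τ : CTy} {t t' : Tm S Γ (.lin υ (.tens τ σ))}
      {s s' : Tm S (τ :: Γ) (.lin σ ρ)} :
      TEq t t' → TEq s s' → TEq (.tensCase t s) (.tensCase t' s')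
  | lapp {Γ : List CTy} {υ σ ρ : LTy} {t t' : Tm S Γ (.cart (.lolli σ ρ))}
      {s s' : Tm S Γ (.lin υ σ)} : TEq t t' → TEq s s' → TEq (.lapp t s) (.lapp t' s')
  | add {Γ : List CTy} {υ σ : LTy} {t t' s s' : Tm S Γ (.lin υ σ)} :
      TEq t t' → TEq s s' → TEq (.add t s) (.add t' s')
  -- `βη`-laws for Cartesian products and functions
  | unit_eta {Γ : List CTy} (t : Tm S Γ (.cart .unit)) : TEq t .unit
  | fst_beta {Γ : List CTy} {τ σ : CTy} (t : Tm S Γ (.cart τ)) (s : Tm S Γ (.cart σ)) :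
      TEq (.fst (.pair t s)) t
  | snd_beta {Γ : List CTy} {τ σ : CTy} (t : Tm S Γ (.cart τ)) (s : Tm S Γ (.cart σ)) :
      TEq (.snd (.pair t s)) s
  | pair_eta {Γ : List CTy} {τ σ : CTy} (t : Tm S Γ (.cart (.prod τ σ))) :
      TEq t (.pair (.fst t) (.snd t))
  | lam_beta {Γ : List CTy} {τ σ : CTy} (t : Tm S (τ :: Γ) (.cart σ)) (s : Tm S Γ (.cart τ)) :
      TEq (.app (.lam t) s) (t.inst s)
  | lam_eta {Γ : List CTy} {τ σ : CTy} (t : Tm S Γ (.cart (.fn τ σ))) :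
      TEq t (.lam (.app (t.ren (Ren.wk Γ τ)) (.var .z)))
  -- `βη`-laws for linear products and functions
  | lunit_eta {Γ : List CTy} {υ : LTy} (t : Tm S Γ (.lin υ .unit)) : TEq t .lunit
  | lfst_beta {Γ : List CTy} {υ σ ρ : LTy} (t : Tm S Γ (.lin υ σ)) (s : Tm S Γ (.lin υ ρ)) :
      TEq (.lfst (.lpair t s)) t
  | lsnd_beta {Γ : List CTy} {υ σ ρ : LTy} (t : Tm S Γ (.lin υ σ)) (s : Tm S Γ (.lin υ ρ)) :
      TEq (.lsnd (.lpair t s)) s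
  | lpair_eta {Γ : List CTy} {υ σ ρ : LTy} (t : Tm S Γ (.lin υ (.prod σ ρ))) :
      TEq t (.lpair (.lfst t) (.lsnd t))
  | lfun_beta {Γ : List CTy} {υ σ : LTy} {τ : CTy} (t : Tm S (τ :: Γ) (.lin υ σ))
      (s : Tm S Γ (.cart τ)) : TEq (.lfunApp (.lfun t) s) (t.inst s)
  | lfun_eta {Γ : List CTy} {υ σ : LTy} {τ : CTy} (t : Tm S Γ (.lin υ (.fn τ σ))) :
      TEq t (.lfun (.lfunApp (t.ren (Ren.wk Γ τ)) (.var .z)))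
  -- `βη`-laws for `!(-) ⊗ (-)` and `⊸`
  | tens_beta {Γ : List CTy} {υ σ ρ : LTy} {τ : CTy} (t : Tm S Γ (.cart τ))
      (s : Tm S Γ (.lin υ σ)) (r : Tm S (τ :: Γ) (.lin σ ρ)) :
      TEq (.tensCase (.tens t s) r) ((r.inst t).lsub s)
  | tens_eta {Γ : List CTy} {υ σ ρ : LTy} {τ : CTy} (t : Tm S Γ (.lin (.tens τ σ) ρ))
      (s : Tm S Γ (.lin υ (.tens τ σ))) :
      TEq (t.lsub s) (.tensCase s ((t.ren (Ren.wk Γ τ)).lsub (.tens (.var .z) .lvar)))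
  | lolli_beta {Γ : List CTy} {υ σ ρ : LTy} (t : Tm S Γ (.lin σ ρ)) (s : Tm S Γ (.lin υ σ)) :
      TEq (.lapp (.llam t) s) (t.lsub s)
  | lolli_eta {Γ : List CTy} {σ ρ : LTy} (t : Tm S Γ (.cart (.lolli σ ρ))) :
      TEq t (.llam (.lapp t .lvar))
  -- commutative monoid and homomorphism laws
  | add_zero {Γ : List CTy} {υ σ : LTy} (t : Tm S Γ (.lin υ σ)) : TEq (.add t .zero) t
  | zero_add {Γ : List CTy} {υ σ : LTy} (t : Tm S Γ (.lin υ σ)) : TEq (.add .zero t) t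
  | add_assoc {Γ : List CTy} {υ σ : LTy} (t s r : Tm S Γ (.lin υ σ)) :
      TEq (.add (.add t s) r) (.add t (.add s r))
  | add_comm {Γ : List CTy} {υ σ : LTy} (t s : Tm S Γ (.lin υ σ)) : TEq (.add t s) (.add s t)
  | lsub_zero {Γ : List CTy} {π υ σ : LTy} (t : Tm S Γ (.lin υ σ)) :
      TEq (t.lsub (.zero : Tm S Γ (.lin π υ))) .zero
  | lsub_add {Γ : List CTy} {π υ σ : LTy} (t : Tm S Γ (.lin υ σ)) (s r : Tm S Γ (.lin π υ)) :
      TEq (t.lsub (.add s r)) (.add (t.lsub s) (t.lsub r))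

namespace Tm

variable {S : Sig.{u, v}}

theorem ren_ren {Γ : List CTy} {j : Jdg} (t : Tm S Γ j) {Δ Θ : List CTy} (ρ : Ren Γ Δ)
    (ρ' : Ren Δ Θ) : (t.ren ρ).ren ρ' = t.ren (fun τ a => ρ' τ (ρ τ a)) := by
  induction t generalizing Δ Θ <;> simp only [ren, Ren.lift_comp, *]

theorem ren_sub {Γ : List CTy} {j : Jdg} (t : Tm S Γ j) {Δ Θ : List CTy} (ρ : Ren Γ Δ)
    (θ : Sub S Δ Θ) : (t.ren ρ).sub θ = t.sub (fun τ a => θ τ (ρ τ a)) := by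
  have key : ∀ {Γ Δ Θ : List CTy} (ρ : Ren Γ Δ) (θ : Sub S Δ Θ) (σ : CTy),
      (fun τ a => θ.lift σ τ (ρ.lift σ τ a)) = Sub.lift (fun τ a => θ τ (ρ τ a)) σ := by
    intro Γ Δ Θ ρ θ σ; funext τ a; cases a <;> rfl
  induction t generalizing Δ Θ <;> simp only [ren, sub, *]

theorem sub_ren {Γ : List CTy} {j : Jdg} (t : Tm S Γ j) {Δ Θ : List CTy} (θ : Sub S Γ Δ)
    (ρ : Ren Δ Θ) : (t.sub θ).ren ρ = t.sub (fun τ a => (θ τ a).ren ρ) := by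
  have key : ∀ {Γ Δ Θ : List CTy} (θ : Sub S Γ Δ) (ρ : Ren Δ Θ) (σ : CTy),
      (fun τ a => (θ.lift σ τ a).ren (ρ.lift σ)) = Sub.lift (fun τ a => (θ τ a).ren ρ) σ := by
    intro Γ Δ Θ θ ρ σ; funext τ a
    cases a
    · rfl
    · simp only [Sub.lift, ren_ren]; rfl
  induction t generalizing Δ Θ <;> simp only [ren, sub, *]

theorem sub_sub {Γ : List CTy} {j : Jdg} (t : Tm S Γ j) {Δ Θ : List CTy} (θ : Sub S Γ Δ)
    (θ' : Sub S Δ Θ) : (t.sub θ).sub θ' = t.sub (fun τ a => (θ τ a).sub θ') := by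
  have key : ∀ {Γ Δ Θ : List CTy} (θ : Sub S Γ Δ) (θ' : Sub S Δ Θ) (σ : CTy),
      (fun τ a => (θ.lift σ τ a).sub (θ'.lift σ)) = Sub.lift (fun τ a => (θ τ a).sub θ') σ := by
    intro Γ Δ Θ θ θ' σ; funext τ a
    cases a
    · rfl
    · simp only [Sub.lift, ren_sub, sub_ren]; rfl
  induction t generalizing Δ Θ <;> simp only [sub, *]

theorem sub_id {Γ : List CTy} {j : Jdg} (t : Tm S Γ j) : t.sub (Sub.id Γ) = t := by
  have key : ∀ (Γ : List CTy) (σ : CTy), (Sub.id (S := S) Γ).lift σ = Sub.id (σ :: Γ) := by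
    intro Γ σ; funext τ a; cases a <;> rfl
  induction t <;> simp only [sub, *]
  rfl

theorem inst_sub {Γ Δ : List CTy} {j : Jdg} {σ : CTy} (t : Tm S (σ :: Γ) j)
    (s : Tm S Γ (.cart σ)) (θ : Sub S Γ Δ) :
    (t.inst s).sub θ = (t.sub (θ.lift σ)).inst (s.sub θ) := by
  unfold inst
  rw [sub_sub, sub_sub]
  congr 1
  funext τ a
  cases a
  · rfl
  · simp only [Sub.lift, ren_sub]; exact (sub_id _).symm

theorem wk_sub_lift {Γ Δ : List CTy} {j : Jdg} (t : Tm S Γ j) (θ : Sub S Γ Δ) (σ : CTy) :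
    (t.ren (Ren.wk Γ σ)).sub (θ.lift σ) = (t.sub θ).ren (Ren.wk Δ σ) := by
  rw [ren_sub, sub_ren]; rfl

theorem ren_eq_sub {Γ Δ : List CTy} {j : Jdg} (t : Tm S Γ j) (ρ : Ren Γ Δ) :
    t.ren ρ = t.sub (fun _ a => .var (ρ _ a)) := by
  conv_lhs => rw [← sub_id (t.ren ρ), ren_sub]
  rfl

theorem wk_inst {Γ : List CTy} {j : Jdg} {σ : CTy} (t : Tm S Γ j) (s : Tm S Γ (.cart σ)) :
    (t.ren (Ren.wk Γ σ)).inst s = t := by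
  unfold inst
  rw [ren_sub]
  exact sub_id t

theorem lsub_ren {π : LTy} : ∀ {Γ Δ : List CTy} {υ σ : LTy} (t : Tm S Γ (.lin υ σ))
    (s : Tm S Γ (.lin π υ)) (ρ : Ren Γ Δ), (t.lsub s).ren ρ = (t.ren ρ).lsub (s.ren ρ)
  | _, _, _, _, .lvar, _, _ => rfl
  | _, _, _, _, .lop o t t', s, ρ => congrArg (Tm.lop o (t.ren ρ)) (lsub_ren t' s ρ)
  | _, _, _, _, .lunit, _, _ => rfl
  | _, _, _, _, .lpair t t', s, ρ => congrArg₂ Tm.lpair (lsub_ren t s ρ) (lsub_ren t' s ρ)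
  | _, _, _, _, .lfst t, s, ρ => congrArg Tm.lfst (lsub_ren t s ρ)
  | _, _, _, _, .lsnd t, s, ρ => congrArg Tm.lsnd (lsub_ren t s ρ)
  | _, _, _, _, .lfun t, s, ρ => congrArg Tm.lfun ((lsub_ren t _ _).trans
      (congrArg (Tm.lsub (t.ren _)) (by rw [ren_ren, ren_ren]; rfl)))
  | _, _, _, _, .lfunApp t t', s, ρ => congrArg (Tm.lfunApp · (t'.ren ρ)) (lsub_ren t s ρ)
  | _, _, _, _, .tens t t', s, ρ => congrArg (Tm.tens (t.ren ρ)) (lsub_ren t' s ρ)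
  | _, _, _, _, .tensCase t t', s, ρ => congrArg (Tm.tensCase · (t'.ren _)) (lsub_ren t s ρ)
  | _, _, _, _, .lapp t t', s, ρ => congrArg (Tm.lapp (t.ren ρ)) (lsub_ren t' s ρ)
  | _, _, _, _, .zero, _, _ => rfl
  | _, _, _, _, .add t t', s, ρ => congrArg₂ Tm.add (lsub_ren t s ρ) (lsub_ren t' s ρ)

theorem lsub_sub {π : LTy} : ∀ {Γ Δ : List CTy} {υ σ : LTy} (t : Tm S Γ (.lin υ σ))
    (s : Tm S Γ (.lin π υ)) (θ : Sub S Γ Δ), (t.lsub s).sub θ = (t.sub θ).lsub (s.sub θ)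
  | _, _, _, _, .lvar, _, _ => rfl
  | _, _, _, _, .lop o t t', s, θ => congrArg (Tm.lop o (t.sub θ)) (lsub_sub t' s θ)
  | _, _, _, _, .lunit, _, _ => rfl
  | _, _, _, _, .lpair t t', s, θ => congrArg₂ Tm.lpair (lsub_sub t s θ) (lsub_sub t' s θ)
  | _, _, _, _, .lfst t, s, θ => congrArg Tm.lfst (lsub_sub t s θ)
  | _, _, _, _, .lsnd t, s, θ => congrArg Tm.lsnd (lsub_sub t s θ)
  | _, _, _, _, .lfun t, s, θ => congrArg Tm.lfun ((lsub_sub t _ _).trans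
      (congrArg (Tm.lsub (t.sub _)) (wk_sub_lift s θ _)))
  | _, _, _, _, .lfunApp t t', s, θ => congrArg (Tm.lfunApp · (t'.sub θ)) (lsub_sub t s θ)
  | _, _, _, _, .tens t t', s, θ => congrArg (Tm.tens (t.sub θ)) (lsub_sub t' s θ)
  | _, _, _, _, .tensCase t t', s, θ => congrArg (Tm.tensCase · (t'.sub _)) (lsub_sub t s θ)
  | _, _, _, _, .lapp t t', s, θ => congrArg (Tm.lapp (t.sub θ)) (lsub_sub t' s θ)
  | _, _, _, _, .zero, _, _ => rfl
  | _, _, _, _, .add t t', s, θ => congrArg₂ Tm.add (lsub_sub t s θ) (lsub_sub t' s θ)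

theorem lsub_lvar : ∀ {Γ : List CTy} {υ σ : LTy} (t : Tm S Γ (.lin υ σ)), t.lsub .lvar = t
  | _, _, _, .lvar => rfl
  | _, _, _, .lop o t t' => congrArg (Tm.lop o t) (lsub_lvar t')
  | _, _, _, .lunit => rfl
  | _, _, _, .lpair t t' => congrArg₂ Tm.lpair (lsub_lvar t) (lsub_lvar t')
  | _, _, _, .lfst t => congrArg Tm.lfst (lsub_lvar t)
  | _, _, _, .lsnd t => congrArg Tm.lsnd (lsub_lvar t)
  | _, _, _, .lfun t => congrArg Tm.lfun (lsub_lvar t)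
  | _, _, _, .lfunApp t t' => congrArg (Tm.lfunApp · t') (lsub_lvar t)
  | _, _, _, .tens t t' => congrArg (Tm.tens t) (lsub_lvar t')
  | _, _, _, .tensCase t t' => congrArg (Tm.tensCase · t') (lsub_lvar t)
  | _, _, _, .lapp t t' => congrArg (Tm.lapp t) (lsub_lvar t')
  | _, _, _, .zero => rfl
  | _, _, _, .add t t' => congrArg₂ Tm.add (lsub_lvar t) (lsub_lvar t')

theorem lsub_lsub {π π' : LTy} : ∀ {Γ : List CTy} {υ σ : LTy} (t : Tm S Γ (.lin υ σ))
    (s : Tm S Γ (.lin π υ)) (r : Tm S Γ (.lin π' π)), (t.lsub s).lsub r = t.lsub (s.lsub r)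
  | _, _, _, .lvar, _, _ => rfl
  | _, _, _, .lop o t t', s, r => congrArg (Tm.lop o t) (lsub_lsub t' s r)
  | _, _, _, .lunit, _, _ => rfl
  | _, _, _, .lpair t t', s, r => congrArg₂ Tm.lpair (lsub_lsub t s r) (lsub_lsub t' s r)
  | _, _, _, .lfst t, s, r => congrArg Tm.lfst (lsub_lsub t s r)
  | _, _, _, .lsnd t, s, r => congrArg Tm.lsnd (lsub_lsub t s r)
  | _, _, _, .lfun t, s, r => congrArg Tm.lfun ((lsub_lsub t _ _).trans
      (congrArg (Tm.lsub t) (lsub_ren s r _).symm))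
  | _, _, _, .lfunApp t t', s, r => congrArg (Tm.lfunApp · t') (lsub_lsub t s r)
  | _, _, _, .tens t t', s, r => congrArg (Tm.tens t) (lsub_lsub t' s r)
  | _, _, _, .tensCase t t', s, r => congrArg (Tm.tensCase · t') (lsub_lsub t s r)
  | _, _, _, .lapp t t', s, r => congrArg (Tm.lapp t) (lsub_lsub t' s r)
  | _, _, _, .zero, _, _ => rfl
  | _, _, _, .add t t', s, r => congrArg₂ Tm.add (lsub_lsub t s r) (lsub_lsub t' s r)

end Tm

namespace TEq

variable {S : Sig.{u, v}}

protected theorem sub {Γ : List CTy} {j : Jdg} {t t' : Tm S Γ j} (h : TEq t t')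
    {Δ : List CTy} (θ : Sub S Γ Δ) : TEq (t.sub θ) (t'.sub θ) := by
  induction h generalizing Δ with
  | refl t => exact .refl _
  | symm _ ih => exact .symm (ih θ)
  | trans _ _ ih ih' => exact .trans (ih θ) (ih' θ)
  | op o _ ih => exact .op o (ih θ)
  | pair _ _ ih ih' => exact .pair (ih θ) (ih' θ)
  | fst _ ih => exact .fst (ih θ)
  | snd _ ih => exact .snd (ih θ)
  | lam _ ih => exact .lam (ih _)
  | app _ _ ih ih' => exact .app (ih θ) (ih' θ)
  | llam _ ih => exact .llam (ih θ)
  | lop o _ _ ih ih' => exact .lop o (ih θ) (ih' θ)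
  | lpair _ _ ih ih' => exact .lpair (ih θ) (ih' θ)
  | lfst _ ih => exact .lfst (ih θ)
  | lsnd _ ih => exact .lsnd (ih θ)
  | lfun _ ih => exact .lfun (ih _)
  | lfunApp _ _ ih ih' => exact .lfunApp (ih θ) (ih' θ)
  | tens _ _ ih ih' => exact .tens (ih θ) (ih' θ)
  | tensCase _ _ ih ih' => exact .tensCase (ih θ) (ih' _)
  | lapp _ _ ih ih' => exact .lapp (ih θ) (ih' θ)
  | add _ _ ih ih' => exact .add (ih θ) (ih' θ)
  | unit_eta t => exact .unit_eta _
  | fst_beta t s => exact .fst_beta _ _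
  | snd_beta t s => exact .snd_beta _ _
  | pair_eta t => exact .pair_eta _
  | lam_beta t s => rw [Tm.inst_sub]; exact .lam_beta _ _
  | lam_eta t =>
    simp only [Tm.sub, Tm.wk_sub_lift]
    exact .lam_eta _
  | lunit_eta t => exact .lunit_eta _
  | lfst_beta t s => exact .lfst_beta _ _
  | lsnd_beta t s => exact .lsnd_beta _ _
  | lpair_eta t => exact .lpair_eta _
  | lfun_beta t s => rw [Tm.inst_sub]; exact .lfun_beta _ _
  | lfun_eta t =>
    simp only [Tm.sub, Tm.wk_sub_lift]
    exact .lfun_eta _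
  | tens_beta t s r => rw [Tm.lsub_sub, Tm.inst_sub]; exact .tens_beta _ _ _
  | tens_eta t s =>
    simp only [Tm.sub, Tm.lsub_sub, Tm.wk_sub_lift]
    exact .tens_eta _ _
  | lolli_beta t s => rw [Tm.lsub_sub]; exact .lolli_beta _ _
  | lolli_eta t => exact .lolli_eta _
  | add_zero t => exact .add_zero _
  | zero_add t => exact .zero_add _
  | add_assoc t s r => exact .add_assoc _ _ _
  | add_comm t s => exact .add_comm _ _
  | lsub_zero t => rw [Tm.lsub_sub]; exact .lsub_zero _
  | lsub_add t s r => simp only [Tm.sub, Tm.lsub_sub]; exact .lsub_add _ _ _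

theorem sub_right {Γ : List CTy} {j : Jdg} (t : Tm S Γ j) {Δ : List CTy} {θ θ' : Sub S Γ Δ}
    (h : ∀ τ a, TEq (θ τ a) (θ' τ a)) : TEq (t.sub θ) (t.sub θ') := by
  have key : ∀ {Γ Δ : List CTy} {θ θ' : Sub S Γ Δ} (_ : ∀ τ a, TEq (θ τ a) (θ' τ a)) (σ : CTy),
      ∀ τ a, TEq (θ.lift σ τ a) (θ'.lift σ τ a) := by
    intro Γ Δ θ θ' h σ τ a
    cases a with
    | z => exact .refl _
    | s a => simp only [Sub.lift, Tm.ren_eq_sub]; exact (h _ a).sub _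
  induction t generalizing Δ with
  | var a => exact h _ a
  | op o t ih => exact .op o (ih h)
  | unit => exact .refl _
  | pair t s ih ih' => exact .pair (ih h) (ih' h)
  | fst t ih => exact .fst (ih h)
  | snd t ih => exact .snd (ih h)
  | lam t ih => exact .lam (ih (key h _))
  | app t s ih ih' => exact .app (ih h) (ih' h)
  | llam t ih => exact .llam (ih h)
  | lvar => exact .refl _
  | lop o t s ih ih' => exact .lop o (ih h) (ih' h)
  | lunit => exact .refl _
  | lpair t s ih ih' => exact .lpair (ih h) (ih' h)
  | lfst t ih => exact .lfst (ih h)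
  | lsnd t ih => exact .lsnd (ih h)
  | lfun t ih => exact .lfun (ih (key h _))
  | lfunApp t s ih ih' => exact .lfunApp (ih h) (ih' h)
  | tens t s ih ih' => exact .tens (ih h) (ih' h)
  | tensCase t s ih ih' => exact .tensCase (ih h) (ih' (key h _))
  | lapp t s ih ih' => exact .lapp (ih h) (ih' h)
  | zero => exact .refl _
  | add t s ih ih' => exact .add (ih h) (ih' h)

theorem lsub_right {π : LTy} : ∀ {Γ : List CTy} {υ σ : LTy} (t : Tm S Γ (.lin υ σ))
    {s s' : Tm S Γ (.lin π υ)}, TEq s s' → TEq (t.lsub s) (t.lsub s')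
  | _, _, _, .lvar, _, _, h => h
  | _, _, _, .lop o t t', _, _, h => .lop o (.refl t) (lsub_right t' h)
  | _, _, _, .lunit, _, _, _ => .refl _
  | _, _, _, .lpair t t', _, _, h => .lpair (lsub_right t h) (lsub_right t' h)
  | _, _, _, .lfst t, _, _, h => .lfst (lsub_right t h)
  | _, _, _, .lsnd t, _, _, h => .lsnd (lsub_right t h)
  | _, _, _, .lfun t, _, _, h => .lfun (lsub_right t (by
      simp only [Tm.ren_eq_sub]; exact h.sub _))
  | _, _, _, .lfunApp t t', _, _, h => .lfunApp (lsub_right t h) (.refl t')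
  | _, _, _, .tens t t', _, _, h => .tens (.refl t) (lsub_right t' h)
  | _, _, _, .tensCase t t', _, _, h => .tensCase (lsub_right t h) (.refl t')
  | _, _, _, .lapp t t', _, _, h => .lapp (.refl t) (lsub_right t' h)
  | _, _, _, .zero, _, _, _ => .refl _
  | _, _, _, .add t t', _, _, h => .add (lsub_right t h) (lsub_right t' h)

theorem lsub_left {π : LTy} {Γ : List CTy} {υ σ : LTy} {t t' : Tm S Γ (.lin υ σ)}
    (h : TEq t t') (s : Tm S Γ (.lin π υ)) : TEq (t.lsub s) (t'.lsub s) :=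
  -- both sides are `β`-redexes of equal terms
  ((lolli_beta t s).symm.trans (.lapp (.llam h) (.refl s))).trans (lolli_beta t' s)

end TEq

/-! ## The syntactic model `LSyn : CSynᵒᵖ → Cat` -/

/-- Terms up to `βη+`-equality. -/
instance Tm.setoid (S : Sig.{u, v}) (Γ : List CTy) (j : Jdg) : Setoid (Tm S Γ j) :=
  ⟨TEq, ⟨.refl, .symm, .trans⟩⟩

/-- The substitution of a term for the only variable of a context. -/
def Sub.single {S : Sig.{u, v}} {Γ : List CTy} {σ : CTy} (t : Tm S Γ (.cart σ)) : Sub S [σ] Γ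
  | _, .z => t
  | _, .s a => a.elim

theorem Sub.single_sub {S : Sig.{u, v}} {Γ Δ : List CTy} {σ : CTy} (t : Tm S Γ (.cart σ))
    (θ : Sub S Γ Δ) :
    (fun ρ a => (Sub.single t ρ a).sub θ) = Sub.single (t.sub θ) := by
  funext ρ a
  rcases a with _ | a
  · rfl
  · exact a.elim

theorem Sub.single_var {S : Sig.{u, v}} (τ : CTy) :
    Sub.single (.var .z) = Sub.id (S := S) [τ] := by
  funext ρ a
  rcases a with _ | a
  · rfl
  · exact a.elim

theorem TEq.single {S : Sig.{u, v}} {Γ : List CTy} {σ : CTy} {t t' : Tm S Γ (.cart σ)}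
    (h : TEq t t') : ∀ ρ a, TEq (Sub.single t ρ a) (Sub.single t' ρ a) := by
  intro ρ a
  rcases a with _ | a
  · exact h
  · exact a.elim

/-- Terms `x : τ ⊢ t : σ` (for `j = cart σ`) or `x : τ; y : υ ⊢ t : σ` (for `j = lin υ σ`) up to
`βη+`-equality. -/
def THom (S : Sig.{u, v}) (τ : CTy) (j : Jdg) : Type (max u v) := Quotient (Tm.setoid S [τ] j)

namespace THom

variable {S : Sig.{u, v}}

/-- The class of a term. -/
def mk {τ : CTy} {j : Jdg} (t : Tm S [τ] j) : THom S τ j := Quotient.mk (Tm.setoid S [τ] j) t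

/-- Identities of `CSyn`. -/
def id (τ : CTy) : THom S τ (.cart τ) := mk (.var .z)

/-- Composition of `CSyn` (for `j = cart ρ`) and change of base of `LSyn` (for `j = lin υ ρ`):
substitution of `f` for the Cartesian variable of `g`. -/
def comp {τ σ : CTy} {j : Jdg} (f : THom S τ (.cart σ)) (g : THom S σ j) : THom S τ j :=
  Quotient.map₂ (fun (t : Tm S [τ] (.cart σ)) (s : Tm S [σ] j) => s.sub (Sub.single t))
    (fun _ _ h _ _ h' => (TEq.sub h' _).trans (TEq.sub_right _ (TEq.single h))) f g

/-- Identities of `LSyn`. -/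
def lid (τ : CTy) (υ : LTy) : THom S τ (.lin υ υ) := mk .lvar

/-- Composition of `LSyn`: substitution of `f` for the linear variable of `g`. -/
def lcomp {τ : CTy} {υ σ ρ : LTy} (f : THom S τ (.lin υ σ)) (g : THom S τ (.lin σ ρ)) :
    THom S τ (.lin υ ρ) :=
  Quotient.map₂ (fun (t : Tm S [τ] (.lin υ σ)) (s : Tm S [τ] (.lin σ ρ)) => s.lsub t)
    (fun t _ h _ s' h' => (TEq.lsub_left h' t).trans (TEq.lsub_right s' h)) f g

theorem id_comp {τ : CTy} {j : Jdg} (f : THom S τ j) : comp (id τ) f = f := by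
  rcases f with ⟨t⟩
  exact congrArg mk ((congrArg t.sub (Sub.single_var τ)).trans (Tm.sub_id t))

theorem comp_id {τ σ : CTy} (f : THom S τ (.cart σ)) : comp f (id σ) = f := by
  rcases f with ⟨t⟩
  rfl

theorem comp_lid {τ σ : CTy} (f : THom S τ (.cart σ)) (υ : LTy) :
    comp f (lid σ υ) = lid τ υ := by
  rcases f with ⟨t⟩
  rfl

theorem assoc {τ σ ρ : CTy} {j : Jdg} (f : THom S τ (.cart σ)) (g : THom S σ (.cart ρ))
    (h : THom S ρ j) : comp (comp f g) h = comp f (comp g h) := by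
  rcases f with ⟨t⟩
  rcases g with ⟨s⟩
  rcases h with ⟨r⟩
  refine congrArg mk (?_ : r.sub _ = (r.sub _).sub _)
  rw [Tm.sub_sub, Sub.single_sub]

theorem comp_lcomp {τ σ : CTy} {υ π ρ : LTy} (f : THom S τ (.cart σ)) (g : THom S σ (.lin υ π))
    (h : THom S σ (.lin π ρ)) : comp f (lcomp g h) = lcomp (comp f g) (comp f h) := by
  rcases f with ⟨t⟩
  rcases g with ⟨s⟩
  rcases h with ⟨r⟩
  exact congrArg mk (Tm.lsub_sub r s _)

theorem lid_lcomp {τ : CTy} {υ σ : LTy} (f : THom S τ (.lin υ σ)) : lcomp (lid τ υ) f = f := by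
  rcases f with ⟨t⟩
  exact congrArg mk (Tm.lsub_lvar t)

theorem lcomp_lid {τ : CTy} {υ σ : LTy} (f : THom S τ (.lin υ σ)) : lcomp f (lid τ σ) = f := by
  rcases f with ⟨t⟩
  rfl

theorem lassoc {τ : CTy} {υ σ ρ π : LTy} (f : THom S τ (.lin υ σ)) (g : THom S τ (.lin σ ρ))
    (h : THom S τ (.lin ρ π)) : lcomp (lcomp f g) h = lcomp f (lcomp g h) := by
  rcases f with ⟨t⟩
  rcases g with ⟨s⟩
  rcases h with ⟨r⟩
  exact congrArg mk (Tm.lsub_lsub r s t).symm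

/-- The substitution `[⟨x, y⟩/z]` for `z : τ * σ`. -/
def pairSub (τ σ : CTy) : Sub S [.prod τ σ] [σ, τ] := Sub.single (.pair (.var (.s .z)) (.var .z))

/-- The substitution `[fst z/x]` for `z : τ * σ`. -/
def fstSub (τ σ : CTy) : Sub S [τ] [.prod τ σ] := Sub.single (.fst (.var .z))

def pair {ρ τ σ : CTy} (f : THom S ρ (.cart τ)) (g : THom S ρ (.cart σ)) :
    THom S ρ (.cart (.prod τ σ)) :=
  Quotient.map₂ (fun (t : Tm S [ρ] (.cart τ)) (s : Tm S [ρ] (.cart σ)) => Tm.pair t s)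
    (fun _ _ h _ _ h' => TEq.pair h h') f g

/-- `x : τ ⊢ λ y. t[⟨x, y⟩/z]` for `z : τ * σ ⊢ t`. -/
def curry {τ σ ρ : CTy} (f : THom S (.prod τ σ) (.cart ρ)) : THom S τ (.cart (.fn σ ρ)) :=
  Quotient.map (fun t : Tm S [.prod τ σ] (.cart ρ) => Tm.lam (t.sub (pairSub τ σ)))
    (fun _ _ h => TEq.lam (TEq.sub h _)) f

def lpair {τ : CTy} {υ σ ρ : LTy} (f : THom S τ (.lin υ σ)) (g : THom S τ (.lin υ ρ)) :
    THom S τ (.lin υ (.prod σ ρ)) :=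
  Quotient.map₂ (fun (t : Tm S [τ] (.lin υ σ)) (s : Tm S [τ] (.lin υ ρ)) => Tm.lpair t s)
    (fun _ _ h _ _ h' => TEq.lpair h h') f g

def add {τ : CTy} {υ σ : LTy} (f g : THom S τ (.lin υ σ)) : THom S τ (.lin υ σ) :=
  Quotient.map₂ (fun (t s : Tm S [τ] (.lin υ σ)) => Tm.add t s)
    (fun _ _ h _ _ h' => TEq.add h h') f g

/-- `x : τ; a : υ ⊢ λ y. t[⟨x, y⟩/z]` for `z : τ * σ; a : υ ⊢ t`. -/
def psi {τ σ : CTy} {υ ρ : LTy} (f : THom S (.prod τ σ) (.lin υ ρ)) :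
    THom S τ (.lin υ (.fn σ ρ)) :=
  Quotient.map (fun t : Tm S [.prod τ σ] (.lin υ ρ) => Tm.lfun (t.sub (pairSub τ σ)))
    (fun _ _ h => TEq.lfun (TEq.sub h _)) f

/-- `z : τ * σ; a : υ ⊢ t[fst z/x] (snd z)` for `x : τ; a : υ ⊢ t`. -/
def psiInv {τ σ : CTy} {υ ρ : LTy} (f : THom S τ (.lin υ (.fn σ ρ))) :
    THom S (.prod τ σ) (.lin υ ρ) :=
  Quotient.map (fun t : Tm S [τ] (.lin υ (.fn σ ρ)) =>
      Tm.lfunApp (t.sub (fstSub τ σ)) (.snd (.var .z)))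
    (fun _ _ h => TEq.lfunApp (TEq.sub h _) (.refl _)) f

/-- `z : τ * σ; a : υ ⊢ t[fst z/x, !(snd z) ⊗ a/b]` for `x : τ; b : !σ ⊗ υ ⊢ t`. -/
def phi {τ σ : CTy} {υ ρ : LTy} (f : THom S τ (.lin (.tens σ υ) ρ)) :
    THom S (.prod τ σ) (.lin υ ρ) :=
  Quotient.map (fun t : Tm S [τ] (.lin (.tens σ υ) ρ) =>
      (t.sub (fstSub τ σ)).lsub (.tens (.snd (.var .z)) .lvar))
    (fun _ _ h => TEq.lsub_left (TEq.sub h _) _) f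

/-- `x : τ; b : !σ ⊗ υ ⊢ case b of !y ⊗ a → t[⟨x, y⟩/z]` for `z : τ * σ; a : υ ⊢ t`. -/
def phiInv {τ σ : CTy} {υ ρ : LTy} (f : THom S (.prod τ σ) (.lin υ ρ)) :
    THom S τ (.lin (.tens σ υ) ρ) :=
  Quotient.map (fun t : Tm S [.prod τ σ] (.lin υ ρ) => Tm.tensCase .lvar (t.sub (pairSub τ σ)))
    (fun _ _ h => TEq.tensCase (.refl _) (TEq.sub h _)) f

def llam {τ : CTy} {υ σ : LTy} (f : THom S τ (.lin υ σ)) : THom S τ (.cart (.lolli υ σ)) :=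
  Quotient.map (fun t : Tm S [τ] (.lin υ σ) => Tm.llam t) (fun _ _ h => TEq.llam h) f

/-- `x : τ; a : υ ⊢ t • a` for `x : τ ⊢ t`. -/
def llamInv {τ : CTy} {υ σ : LTy} (f : THom S τ (.cart (.lolli υ σ))) : THom S τ (.lin υ σ) :=
  Quotient.map (fun t : Tm S [τ] (.cart (.lolli υ σ)) => Tm.lapp t .lvar)
    (fun _ _ h => TEq.lapp h (.refl _)) f

end THom

/-- The syntactic category of the Cartesian types of the target language: morphisms are terms
`x : τ ⊢ t : σ` up to `βη+`-equality. -/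
structure CSyn (S : Sig.{u, v}) : Type where
  ty : CTy

instance (S : Sig.{u, v}) : Category.{max u v} (CSyn S) where
  Hom τ σ := THom S τ.ty (.cart σ.ty)
  id τ := THom.id τ.ty
  comp f g := THom.comp f g
  id_comp f := THom.id_comp f
  comp_id f := THom.comp_id f
  assoc f g h := THom.assoc f g h

/-- The morphism of `CSyn` represented by a term. -/
def CSyn.homMk {S : Sig.{u, v}} {τ σ : CTy} (t : Tm S [τ] (.cart σ)) : (⟨τ⟩ : CSyn S) ⟶ ⟨σ⟩ :=
  THom.mk t

instance (S : Sig.{u, v}) : CCOps (CSyn S) where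
  one := ⟨.unit⟩
  prod τ σ := ⟨.prod τ.ty σ.ty⟩
  exp τ σ := ⟨.fn τ.ty σ.ty⟩
  bang _ := CSyn.homMk .unit
  fst _ _ := CSyn.homMk (.fst (.var .z))
  snd _ _ := CSyn.homMk (.snd (.var .z))
  pair f g := THom.pair f g
  ev _ _ := CSyn.homMk (.app (.fst (.var .z)) (.snd (.var .z)))
  curry f := THom.curry f

/-- The locally indexed category `LSyn : CSynᵒᵖ → Cat`: objects are linear types, morphisms
`υ → σ` over `τ` are terms `x : τ; y : υ ⊢ t : σ` up to `βη+`-equality, and change of base is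
substitution for the Cartesian variable. -/
def LSyn (S : Sig.{u, v}) : LocallyIndexed.{0, max u v, 0, max u v} (CSyn S) where
  Obj := LTy
  Hom τ υ σ := THom S τ.ty (.lin υ σ)
  id τ υ := THom.lid τ.ty υ
  comp f g := THom.lcomp f g
  map f _ _ g := THom.comp f g
  id_comp f := THom.lid_lcomp f
  comp_id f := THom.lcomp_lid f
  assoc f g h := THom.lassoc f g h
  map_id f υ := THom.comp_lid f υ
  map_comp f _ _ _ g h := THom.comp_lcomp f g h
  id_map f := THom.id_comp f
  comp_map f g _ _ h := THom.assoc f g h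

instance (S : Sig.{u, v}) : LinOps (LSyn S) where
  one := LTy.unit
  prod := LTy.prod
  fn τ := LTy.fn τ.ty
  tens τ := LTy.tens τ.ty
  lolli υ σ := ⟨.lolli υ σ⟩
  bang _ _ := THom.mk .lunit
  fst _ _ _ := THom.mk (.lfst .lvar)
  snd _ _ _ := THom.mk (.lsnd .lvar)
  pair f g := THom.lpair f g
  zero _ _ _ := THom.mk .zero
  add f g := THom.add f g
  psi f := THom.psi f
  psiInv f := THom.psiInv f
  phi f := THom.phi f
  phiInv f := THom.phiInv f
  lam f := THom.llam f
  lamInv f := THom.llamInv f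

/-! ## Automatic differentiation -/

/-- The target category of forward AD: objects are pairs of a Cartesian type `τ₁` and a linear
type `τ₂`. -/
abbrev Fwd (S : Sig.{u, v}) : Type := Total (LSyn S)

/-- The target category of reverse AD. -/
abbrev Rev (S : Sig.{u, v}) : Type := TotalOp (LSyn S)

/-- The morphism of `Σ_CSyn LSyn` given by a pair of terms `x : τ₁ ⊢ t₁ : σ₁` and
`x : τ₁; y : τ₂ ⊢ t₂ : σ₂`. -/
def Fwd.homMk {S : Sig.{u, v}} {τ₁ σ₁ : CTy} {τ₂ σ₂ : LTy} (t₁ : Tm S [τ₁] (.cart σ₁))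
    (t₂ : Tm S [τ₁] (.lin τ₂ σ₂)) : (⟨⟨τ₁⟩, τ₂⟩ : Fwd S) ⟶ ⟨⟨σ₁⟩, σ₂⟩ :=
  ⟨CSyn.homMk t₁, THom.mk t₂⟩

/-- The morphism of `Σ_CSyn LSynᵒᵖ` given by a pair of terms `x : τ₁ ⊢ t₁ : σ₁` and
`x : τ₁; y : σ₂ ⊢ t₂ : τ₂`. -/
def Rev.homMk {S : Sig.{u, v}} {τ₁ σ₁ : CTy} {τ₂ σ₂ : LTy} (t₁ : Tm S [τ₁] (.cart σ₁))
    (t₂ : Tm S [τ₁] (.lin σ₂ τ₂)) : (⟨⟨τ₁⟩, τ₂⟩ : Rev S) ⟶ ⟨⟨σ₁⟩, σ₂⟩ :=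
  ⟨CSyn.homMk t₁, THom.mk t₂⟩

/-- A choice of terms `x : realⁿ¹ * … * realⁿᵏ; y : realⁿ¹ * … * realⁿᵏ ⊢ Dop(x; y) : realᵐ`
representing the derivatives of the primitive operations. -/
def DerivativeTerms (S : Sig.{u, v}) : Type (max u v) :=
  ∀ (ns : List ℕ) (m : ℕ), S.Op ns m → Tm S [CTy.dom ns] (.lin (LTy.dom ns) (.real m))

/-- A choice of terms `x : realⁿ¹ * … * realⁿᵏ; y : realᵐ ⊢ Dopᵗ(x; y) : realⁿ¹ * … * realⁿᵏ`
representing the transposed derivatives of the primitive operations. -/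
def TransposedDerivativeTerms (S : Sig.{u, v}) : Type (max u v) :=
  ∀ (ns : List ℕ) (m : ℕ), S.Op ns m → Tm S [CTy.dom ns] (.lin (.real m) (LTy.dom ns))

/-- Forward AD: a Cartesian closed functor which sends `realⁿ` to `(realⁿ, realⁿ)` and each
primitive operation `op` to `(op, Dop)`. -/
structure IsForwardAD {S : Sig.{u, v}} (Dop : DerivativeTerms S) (F : Syn S ⥤ Fwd S) : Prop where
  cartesianClosed : IsCartesianClosedFunctor F
  obj_real (n : ℕ) : F.obj ⟨.real n⟩ = ⟨⟨.real n⟩, .real n⟩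
  map_op (ns : List ℕ) (m : ℕ) (o : S.Op ns m) :
    F.map (Syn.homMk (.op o (.var .z))) ≍ Fwd.homMk (.op o (.var .z)) (Dop ns m o)

/-- Reverse AD: a Cartesian closed functor which sends `realⁿ` to `(realⁿ, realⁿ)` and each
primitive operation `op` to `(op, Dopᵗ)`. -/
structure IsReverseAD {S : Sig.{u, v}} (Dopt : TransposedDerivativeTerms S) (F : Syn S ⥤ Rev S) :
    Prop where
  cartesianClosed : IsCartesianClosedFunctor F
  obj_real (n : ℕ) : F.obj ⟨.real n⟩ = ⟨⟨.real n⟩, .real n⟩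
  map_op (ns : List ℕ) (m : ℕ) (o : S.Op ns m) :
    F.map (Syn.homMk (.op o (.var .z))) ≍ Rev.homMk (.op o (.var .z)) (Dopt ns m o)

end AD

open AD

-- `Syn S` is the free Cartesian closed category on the objects `realⁿ` and the primitive
-- operations: a strict Cartesian closed functor out of it amounts to a choice of images for these
-- generators (`Syn.existsUnique_functor`). For existence, terms are interpreted in an arbitrary
-- Cartesian closed category, and soundness `SEq.interp_eq`, which rests on the substitution lemma
-- `STm.interp_sub`, makes this well defined on `βη`-classes. For uniqueness (`Syn.functor_ext`),
-- every term is built from variables and generators by operations which a strict functor has to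
-- preserve.
--
-- It remains to see that both targets are Cartesian closed, and this holds for the total categories
-- of any model satisfying `IsLinearModel`. In `Σ_C L`, a morphism `(A₁, A₂) × (B₁, B₂) ⟶ (X₁, X₂)`
-- is a base map `A₁ × B₁ ⟶ X₁` with a fibre map `A₂ × B₂ ⟶ X₂` over `A₁ × B₁`. As `A₂ × B₂` is a
-- biproduct, the fibre map splits into a part out of `A₂` and a part out of `B₂`. By `psi` the
-- first is a map `A₂ ⟶ (B₁ ⇒ X₂)` over `A₁`. By `lam` the second is a base map `A₁ × B₁ ⟶ (B₂ ⊸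
-- X₂)`, which is paired with the given base map and curried. The results are the two components of
-- a map into the exponential. In `Σ_C Lᵒᵖ` the fibre map is `X₂ ⟶ A₂ × B₂`; its part into `A₂`
-- becomes a map `!B₁ ⊗ X₂ ⟶ A₂` over `A₁` by `phi`, and its part into `B₂` is again absorbed into
-- the base by `lam`.
--
-- The syntactic model has this structure (`CSyn.isCartesianClosed`, `LSyn.isLinearModel`): each law
-- is a `βη+`-law combined with the substitution calculus. Finally, `βη`-equal programs are a single
-- morphism of `Syn S`, and two target terms have the same class only if they are `βη+`-equal, which
-- gives the last claim.

namespace AD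

open CCOps

/-! ## Calculations in Cartesian closed categories -/

namespace IsCartesianClosed

variable {C : Type u₁} [Category.{v₁} C] [CCOps C]

theorem bang_ext (hC : IsCartesianClosed C) {A : C} (f g : A ⟶ one) : f = g :=
  (hC.bang_uniq f).trans (hC.bang_uniq g).symm

theorem pair_fst_assoc (hC : IsCartesianClosed C) {X A B Y : C} (f : X ⟶ A)
    (g : X ⟶ B) (h : A ⟶ Y) :
    pair f g ≫ fst A B ≫ h = f ≫ h := by
  rw [← Category.assoc, hC.pair_fst]

theorem pair_snd_assoc (hC : IsCartesianClosed C) {X A B Y : C} (f : X ⟶ A)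
    (g : X ⟶ B) (h : B ⟶ Y) :
    pair f g ≫ snd A B ≫ h = g ≫ h := by
  rw [← Category.assoc, hC.pair_snd]

theorem comp_pair (hC : IsCartesianClosed C) {Y X A B : C} (h : Y ⟶ X) (f : X ⟶ A) (g : X ⟶ B) :
    h ≫ pair f g = pair (h ≫ f) (h ≫ g) := by
  rw [← hC.pair_uniq (h ≫ pair f g), Category.assoc, Category.assoc, hC.pair_fst, hC.pair_snd]

theorem pair_fst_snd (hC : IsCartesianClosed C) (A B : C) : pair (fst A B) (snd A B) = 𝟙 _ := by
  simpa using hC.pair_uniq (𝟙 (prod A B))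

theorem curry_ev_assoc (hC : IsCartesianClosed C) {A B X Y : C} (f : prod A B ⟶ X) (h : X ⟶ Y) :
    pair (fst A B ≫ curry f) (snd A B) ≫ ev B X ≫ h = f ≫ h := by
  rw [← Category.assoc, hC.curry_ev]

/-- The `β`-law in an environment `g` with argument `h`: precompose `curry_ev` with `pair g h`. -/
theorem pair_curry_ev (hC : IsCartesianClosed C) {A B X Y : C} (f : prod A B ⟶ X)
    (g : Y ⟶ A) (h : Y ⟶ B) :
    pair (g ≫ curry f) h ≫ ev B X = pair g h ≫ f := by
  conv_rhs => rw [← hC.curry_ev f, ← Category.assoc, hC.comp_pair, hC.pair_fst_assoc, hC.pair_snd]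

theorem comp_curry (hC : IsCartesianClosed C) {Y A B X : C} (h : Y ⟶ A) (f : prod A B ⟶ X) :
    h ≫ curry f = curry (pair (fst Y B ≫ h) (snd Y B) ≫ f) := by
  rw [← hC.curry_uniq (h ≫ curry f), ← Category.assoc, hC.pair_curry_ev]

/-- The form of `pair_uniq` that applies to the image of a product under a strict functor. That
image equals a product only propositionally, so the object and its projections are variables here
and the equations can be eliminated. -/
theorem heq_pair (hC : IsCartesianClosed C) {X A B Z : C} (hZ : Z = prod A B)
    {p : Z ⟶ A} {q : Z ⟶ B} (hp : p ≍ fst A B) (hq : q ≍ snd A B) (h : X ⟶ Z) : h ≍ pair (h ≫ p) (h ≫ q) := by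
  subst hZ
  cases hp
  cases hq
  exact heq_of_eq (hC.pair_uniq h).symm

/-- The analogue for exponentials, by `curry_uniq`. In the application `P`, `Q`, `E` and the
structure maps are images under a functor, `r` is the image of `(curry f) × id`, and hence `r ≫ e`
is the image of `f`. -/
theorem heq_curry (hC : IsCartesianClosed C) {A B X E P Q : C} (hE : E = exp B X)
    (hP : P = prod E B) (hQ : Q = prod A B)
    {p : P ⟶ E} {p' : P ⟶ B} {q : Q ⟶ A} {q' : Q ⟶ B} {e : P ⟶ X} (hp : p ≍ fst E B)
    (hp' : p' ≍ snd E B) (hq : q ≍ fst A B) (hq' : q' ≍ snd A B) (he : e ≍ ev B X)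
    (g : A ⟶ E) {r : Q ⟶ P} (hr : r ≫ p = q ≫ g) (hr' : r ≫ p' = q') {k : prod A B ⟶ X}
    (hk : r ≫ e ≍ k) : g ≍ curry k := by
  subst hE hP hQ
  cases hp
  cases hp'
  cases hq
  cases hq'
  cases he
  cases hk
  rw [← hC.pair_uniq r, hr, hr', hC.curry_uniq]

end IsCartesianClosed

-- Congruence of the categorical operations under heterogeneous equality

theorem heq_comp {C : Type u₁} [Category.{v₁} C] {X X' Y Y' Z Z' : C} (hX : X = X') (hY : Y = Y')
    (hZ : Z = Z') {f : X ⟶ Y} {f' : X' ⟶ Y'} {g : Y ⟶ Z} {g' : Y' ⟶ Z'} (hf : f ≍ f')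
    (hg : g ≍ g') : f ≫ g ≍ f' ≫ g' := by
  subst hX hY hZ
  cases hf
  cases hg
  rfl

section HEq

variable {C : Type u₁} [Category.{v₁} C] [CCOps C]

theorem fst_heq {A A' B B' : C} (hA : A = A') (hB : B = B') : fst A B ≍ fst A' B' := by
  subst hA hB; rfl

theorem snd_heq {A A' B B' : C} (hA : A = A') (hB : B = B') : snd A B ≍ snd A' B' := by
  subst hA hB; rfl

theorem ev_heq {A A' B B' : C} (hA : A = A') (hB : B = B') : ev A B ≍ ev A' B' := by
  subst hA hB; rfl

theorem bang_heq {A A' : C} (hA : A = A') : bang A ≍ bang A' := by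
  subst hA; rfl

theorem pair_heq {X X' A A' B B' : C} (hX : X = X') (hA : A = A') (hB : B = B')
    {f : X ⟶ A} {f' : X' ⟶ A'} {g : X ⟶ B} {g' : X' ⟶ B'} (hf : f ≍ f') (hg : g ≍ g') :
    pair f g ≍ pair f' g' := by
  subst hX hA hB
  cases hf
  cases hg
  rfl

theorem curry_heq {A A' B B' X X' : C} (hA : A = A') (hB : B = B') (hX : X = X')
    {f : prod A B ⟶ X} {f' : prod A' B' ⟶ X'} (hf : f ≍ f') : curry f ≍ curry f' := by
  subst hA hB hX
  cases hf
  rfl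

end HEq

-- Strict functors commute with `bang`, `pair` and `curry`

namespace IsCartesianClosedFunctor

variable {C : Type u₁} [Category.{v₁} C] [CCOps C] {D : Type u₂} [Category.{v₂} D] [CCOps D]
  {F : C ⥤ D}

theorem map_bang (hF : IsCartesianClosedFunctor F) (hD : IsCartesianClosed D) (A : C) :
    F.map (bang A) ≍ bang (F.obj A) := by
  -- The codomain is generalised to a variable, since an equation about `F.obj one` cannot be
  -- eliminated by substitution.
  have key : ∀ {Z : D} (_ : Z = one) (f : F.obj A ⟶ Z), f ≍ bang (F.obj A) := by
    intro Z hZ f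
    subst hZ
    exact heq_of_eq (hD.bang_uniq f)
  exact key hF.obj_one _

theorem map_pair (hF : IsCartesianClosedFunctor F) (hC : IsCartesianClosed C)
    (hD : IsCartesianClosed D) {X A B : C} (f : X ⟶ A)
    (g : X ⟶ B) : F.map (pair f g) ≍ pair (F.map f) (F.map g) := by
  have h := hD.heq_pair (hF.obj_prod A B) (hF.map_fst A B) (hF.map_snd A B) (F.map (pair f g))
  rwa [← F.map_comp, ← F.map_comp, hC.pair_fst, hC.pair_snd] at h

/-- A transpose is characterised by its composite with evaluation, and `F` preserves evaluation. The
map `k` is `F.map f` read with the product of the images as its source. -/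
theorem map_curry (hF : IsCartesianClosedFunctor F) (hC : IsCartesianClosed C)
    (hD : IsCartesianClosed D) {A B X : C} (f : prod A B ⟶ X) {k : prod (F.obj A) (F.obj B) ⟶ F.obj X} (hk : F.map f ≍ k) :
    F.map (curry f) ≍ curry k := by
  refine hD.heq_curry (hF.obj_exp B X) (hF.obj_prod _ B) (hF.obj_prod A B)
    (hF.map_fst _ _) (hF.map_snd _ _) (hF.map_fst A B) (hF.map_snd A B)
    ((hF.map_ev B X).trans HEq.rfl) (F.map (curry f))
    (r := F.map (pair (fst A B ≫ curry f) (snd A B))) ?_ ?_ ?_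
  · rw [← F.map_comp, ← F.map_comp, hC.pair_fst]
  · rw [← F.map_comp, hC.pair_snd]
  · rw [← F.map_comp, hC.curry_ev]
    exact hk

end IsCartesianClosedFunctor

/-! ## The syntactic category of the source language is Cartesian closed -/

theorem SHom.sound {S : Sig.{u, v}} {τ σ : STy} {t s : STm S [τ] σ} (h : SEq t s) :
    SHom.mk t = SHom.mk s := Quotient.sound (s := STm.setoid S [τ] σ) h

theorem SSub.single_comp {S : Sig.{u, v}} {τ σ ρ : STy} (t : STm S [τ] σ) (s : STm S [σ] ρ)
    {Γ : List STy} (r : STm S Γ τ) :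
    (s.sub (.single t)).sub (.single r) = s.sub (.single (t.sub (.single r))) := by
  rw [STm.sub_sub, SSub.single_sub]

theorem Syn.isCartesianClosed (S : Sig.{u, v}) : IsCartesianClosed (Syn S) where
  bang_uniq f := by
    rcases f with ⟨t⟩
    exact SHom.sound (.unit_eta t)
  pair_fst f g := by
    rcases f with ⟨t⟩
    rcases g with ⟨s⟩
    exact SHom.sound (.fst_beta t s)
  pair_snd f g := by
    rcases f with ⟨t⟩
    rcases g with ⟨s⟩
    exact SHom.sound (.snd_beta t s)
  pair_uniq h := by
    rcases h with ⟨t⟩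
    exact SHom.sound (.symm (.pair_eta t))
  curry_ev {A B X} f := by
    rcases f with ⟨t⟩
    refine SHom.sound (.trans (.app (.fst_beta _ _) (.snd_beta _ _)) (.trans (.fn_beta _ _) ?_))
    simp only [STm.inst, STm.sub_sub, SSub.single_sub]
    -- After the `β`-steps, `⟨fst z, snd z⟩` is substituted for `z` in `t`; surjective pairing
    -- compares this with the identity substitution.
    conv_rhs => rw [← STm.sub_id t, ← SSub.single_var]
    exact .sub_right t (.single (.symm (.pair_eta _)))
  curry_uniq {A B X} g := by
    rcases g with ⟨t⟩
    -- Expanding `t` by `η` leaves two bodies to compare under the abstraction.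
    refine SHom.sound (.trans (.lam ?_) (.symm (.fn_eta t)))
    refine .app ?_ (.trans (.snd_beta _ _) (.snd_beta _ _))
    change SEq (STm.fst (.pair ((t.sub _).sub _) _)) _
    refine .trans (.fst_beta _ _) ?_
    rw [SSub.single_comp, STm.ren_eq_sub]
    refine .sub_right t fun κ b => ?_
    rcases b with _ | b
    · exact .fst_beta _ _
    · exact b.elim

/-! ## The universal property of the syntactic category of the source language -/

section Interpretation

variable {S : Sig.{u, v}} {C : Type u₁} [Category.{v₁} C] [CCOps C]

/-- The interpretation of types which extends a choice `R` of the objects `realⁿ`. -/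
def STy.interp (R : ℕ → C) : STy → C
  | .real n => R n
  | .unit => one
  | .prod τ σ => CCOps.prod (τ.interp R) (σ.interp R)
  | .fn τ σ => CCOps.exp (τ.interp R) (σ.interp R)

/-- The interpretation of contexts as iterated products. -/
def ctxInterp (R : ℕ → C) : List STy → C
  | [] => one
  | τ :: Γ => CCOps.prod (ctxInterp R Γ) (τ.interp R)

def Var.interp (R : ℕ → C) : ∀ {Γ : List STy} {τ : STy}, Var Γ τ → (ctxInterp R Γ ⟶ τ.interp R)
  | _, _, .z => CCOps.snd _ _
  | _, _, .s a => CCOps.fst _ _ ≫ a.interp R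

/-- Interpretations of the primitive operations. -/
abbrev OpInterp (S : Sig.{u, v}) (R : ℕ → C) : Type (max u v₁) :=
  ∀ (ns : List ℕ) (m : ℕ), S.Op ns m → ((STy.dom ns).interp R ⟶ R m)

/-- The interpretation of terms which extends one of the primitive operations. -/
def STm.interp {R : ℕ → C} (O : OpInterp S R) :
    ∀ {Γ : List STy} {τ : STy}, STm S Γ τ → (ctxInterp R Γ ⟶ τ.interp R)
  | _, _, .var a => a.interp R
  | _, _, .op o t => t.interp O ≫ O _ _ o
  | _, _, .unit => CCOps.bang _
  | _, _, .pair t s => CCOps.pair (t.interp O) (s.interp O)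
  | _, _, .fst t => t.interp O ≫ CCOps.fst _ _
  | _, _, .snd t => t.interp O ≫ CCOps.snd _ _
  | _, _, .lam t => CCOps.curry (t.interp O)
  | _, _, .app t s => CCOps.pair (t.interp O) (s.interp O) ≫ CCOps.ev _ _

variable {R : ℕ → C} (O : OpInterp S R)

/-- A value as an environment for a context with a single variable. -/
def ctxSingle (R : ℕ → C) (τ : STy) : τ.interp R ⟶ ctxInterp R [τ] :=
  CCOps.pair (CCOps.bang _) (𝟙 _)

theorem ctxSingle_var (hC : IsCartesianClosed C) (τ : STy) :
    ctxSingle R τ ≫ Var.interp R .z = 𝟙 _ :=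
  hC.pair_snd _ _

/-- The environment map `m` is tied to `ρ` only through its effect on variables, so that the
induction passes under binders. Renamings are treated before substitutions because lifting a
substitution weakens its terms. -/
theorem STm.interp_ren (hC : IsCartesianClosed C) {Γ : List STy} {τ : STy} (t : STm S Γ τ)
    {Δ : List STy} (ρ : Ren Γ Δ) (m : ctxInterp R Δ ⟶ ctxInterp R Γ)
    (hm : ∀ τ (a : Var Γ τ), m ≫ a.interp R = (ρ τ a).interp R) :
    (t.ren ρ).interp O = m ≫ t.interp O := by
  induction t generalizing Δ with
  | var a => exact (hm _ a).symm
  | op o t ih => exact (congrArg (· ≫ O _ _ o) (ih ρ m hm)).trans (Category.assoc _ _ _)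
  | unit => exact hC.bang_ext _ _
  | pair t s ih ih' =>
    exact (congrArg₂ CCOps.pair (ih ρ m hm) (ih' ρ m hm)).trans (hC.comp_pair _ _ _).symm
  | fst t ih => exact (congrArg (· ≫ CCOps.fst _ _) (ih ρ m hm)).trans (Category.assoc _ _ _)
  | snd t ih => exact (congrArg (· ≫ CCOps.snd _ _) (ih ρ m hm)).trans (Category.assoc _ _ _)
  | @lam Γ σ π t ih =>
    -- Under the binder the environment map is `m × id`; naturality of `curry` then moves `m`
    -- outside.
    have key := ih (ρ.lift σ) (CCOps.pair (CCOps.fst (ctxInterp R Δ) (σ.interp R) ≫ m)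
      (CCOps.snd (ctxInterp R Δ) (σ.interp R)) : ctxInterp R (σ :: Δ) ⟶ ctxInterp R (σ :: Γ)) ?_
    · exact (congrArg CCOps.curry key).trans (hC.comp_curry _ _).symm
    intro τ a
    cases a with
    | z => exact hC.pair_snd _ _
    | s a => exact (hC.pair_fst_assoc _ _ _).trans ((Category.assoc _ _ _).trans
        (congrArg (CCOps.fst _ _ ≫ ·) (hm _ a)))
  | app t s ih ih' =>
    exact (congrArg (· ≫ CCOps.ev _ _) ((congrArg₂ CCOps.pair (ih ρ m hm) (ih' ρ m hm)).trans
      (hC.comp_pair _ _ _).symm)).trans (Category.assoc _ _ _)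

theorem STm.interp_wk (hC : IsCartesianClosed C) {Γ : List STy} {τ : STy} (t : STm S Γ τ)
    (σ : STy) : (t.ren (Ren.wk Γ σ)).interp O = CCOps.fst _ _ ≫ t.interp O :=
  t.interp_ren O hC _ _ fun _ _ => rfl

/-- Substitution is precomposition with a map of environments, by the same induction as for
renamings; `STm.interp_wk` handles the weakened terms under a binder. -/
theorem STm.interp_sub (hC : IsCartesianClosed C) {Γ : List STy} {τ : STy} (t : STm S Γ τ)
    {Δ : List STy} (θ : SSub S Γ Δ) (m : ctxInterp R Δ ⟶ ctxInterp R Γ)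
    (hm : ∀ τ (a : Var Γ τ), m ≫ a.interp R = (θ τ a).interp O) :
    (t.sub θ).interp O = m ≫ t.interp O := by
  induction t generalizing Δ with
  | var a => exact (hm _ a).symm
  | op o t ih => exact (congrArg (· ≫ O _ _ o) (ih θ m hm)).trans (Category.assoc _ _ _)
  | unit => exact hC.bang_ext _ _
  | pair t s ih ih' =>
    exact (congrArg₂ CCOps.pair (ih θ m hm) (ih' θ m hm)).trans (hC.comp_pair _ _ _).symm
  | fst t ih => exact (congrArg (· ≫ CCOps.fst _ _) (ih θ m hm)).trans (Category.assoc _ _ _)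
  | snd t ih => exact (congrArg (· ≫ CCOps.snd _ _) (ih θ m hm)).trans (Category.assoc _ _ _)
  | @lam Γ σ π t ih =>
    have key := ih (θ.lift σ) (CCOps.pair (CCOps.fst (ctxInterp R Δ) (σ.interp R) ≫ m)
      (CCOps.snd (ctxInterp R Δ) (σ.interp R)) : ctxInterp R (σ :: Δ) ⟶ ctxInterp R (σ :: Γ)) ?_
    · exact (congrArg CCOps.curry key).trans (hC.comp_curry _ _).symm
    intro τ a
    cases a with
    | z => exact hC.pair_snd _ _
    | s a => exact (hC.pair_fst_assoc _ _ _).trans ((Category.assoc _ _ _).trans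
        ((congrArg (CCOps.fst _ _ ≫ ·) (hm _ a)).trans (STm.interp_wk O hC _ _).symm))
  | app t s ih ih' =>
    exact (congrArg (· ≫ CCOps.ev _ _) ((congrArg₂ CCOps.pair (ih θ m hm) (ih' θ m hm)).trans
      (hC.comp_pair _ _ _).symm)).trans (Category.assoc _ _ _)

theorem STm.interp_inst (hC : IsCartesianClosed C) {Γ : List STy} {τ σ : STy}
    (t : STm S (σ :: Γ) τ) (s : STm S Γ σ) :
    (t.inst s).interp O = CCOps.pair (𝟙 _) (s.interp O) ≫ t.interp O := by
  refine t.interp_sub O hC _ _ fun τ a => ?_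
  cases a with
  | z => exact hC.pair_snd _ _
  | s a => exact (hC.pair_fst_assoc _ _ _).trans (Category.id_comp _)

theorem SEq.interp_eq (hC : IsCartesianClosed C) {Γ : List STy} {τ : STy} {t s : STm S Γ τ}
    (h : SEq t s) : t.interp O = s.interp O := by
  induction h with
  | refl t => rfl
  | symm _ ih => exact ih.symm
  | trans _ _ ih ih' => exact ih.trans ih'
  | op o _ ih => exact congrArg (· ≫ O _ _ o) ih
  | pair _ _ ih ih' => exact congrArg₂ CCOps.pair ih ih'
  | fst _ ih => exact congrArg (· ≫ CCOps.fst _ _) ih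
  | snd _ ih => exact congrArg (· ≫ CCOps.snd _ _) ih
  | lam _ ih => exact congrArg CCOps.curry ih
  | app _ _ ih ih' => exact congrArg (· ≫ CCOps.ev _ _) (congrArg₂ CCOps.pair ih ih')
  | unit_eta t => exact hC.bang_ext _ _
  | fst_beta t s => exact hC.pair_fst _ _
  | snd_beta t s => exact hC.pair_snd _ _
  | pair_eta t => exact (hC.pair_uniq _).symm
  | fn_beta t s =>
    rw [STm.interp_inst O hC]
    -- A `β`-step leaves the environment unchanged, so the environment map is the identity, which
    -- has to be inserted.
    refine Eq.trans ?_ (hC.pair_curry_ev (t.interp O) (𝟙 _) (s.interp O))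
    exact congrArg (CCOps.pair · _ ≫ CCOps.ev _ _) (Category.id_comp _).symm
  | fn_eta t =>
    simp only [STm.interp, STm.interp_wk O hC]
    exact (hC.curry_uniq _).symm

/-- The Cartesian closed functor from the syntactic category which extends an interpretation of the
primitive operations. -/
def Syn.lift (hC : IsCartesianClosed C) : Syn S ⥤ C where
  obj τ := τ.ty.interp R
  map {τ σ} f := Quotient.lift (s := STm.setoid S [τ.ty] σ.ty)
    (fun t : STm S [τ.ty] σ.ty => ctxSingle R τ.ty ≫ t.interp O)
    (fun _ _ h => congrArg _ (SEq.interp_eq O hC h)) f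
  map_id τ := ctxSingle_var hC τ.ty
  map_comp {τ σ ρ} f g := by
    rcases f with ⟨t⟩
    rcases g with ⟨s⟩
    -- A context with one variable is interpreted by `one × σ` rather than by `σ`, so the value of
    -- `t` becomes an environment for `s` only after `ctxSingle`.
    have hs := s.interp_sub O hC (SSub.single t) (t.interp O ≫ ctxSingle R σ.ty) (by
      intro τ a
      rcases a with _ | a
      · exact (Category.assoc _ _ _).trans
          ((congrArg _ (ctxSingle_var hC _)).trans (Category.comp_id _))
      · exact a.elim)
    exact (congrArg (ctxSingle R τ.ty ≫ ·) (hs.trans (Category.assoc _ _ _))).trans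
      (Category.assoc _ _ _).symm

theorem Syn.lift_isCartesianClosedFunctor (hC : IsCartesianClosed C) :
    IsCartesianClosedFunctor (Syn.lift O hC) where
  obj_one := rfl
  obj_prod _ _ := rfl
  obj_exp _ _ := rfl
  map_fst A B := heq_of_eq ((hC.pair_snd_assoc _ _ _).trans (Category.id_comp _))
  map_snd A B := heq_of_eq ((hC.pair_snd_assoc _ _ _).trans (Category.id_comp _))
  map_ev A B := by
    let p : ctxInterp R [.prod (.fn A.ty B.ty) A.ty] ⟶
        CCOps.prod (CCOps.exp (A.ty.interp R) (B.ty.interp R)) (A.ty.interp R) :=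
      Var.interp R .z
    -- The term for evaluation applies `fst z` to `snd z`; surjective pairing reassembles these into
    -- the variable `p` itself.
    have h : CCOps.pair (p ≫ CCOps.fst _ _) (p ≫ CCOps.snd _ _) = p := hC.pair_uniq p
    exact heq_of_eq ((congrArg (ctxSingle R _ ≫ · ≫ CCOps.ev _ _) h).trans
      ((hC.pair_snd_assoc _ _ _).trans (Category.id_comp _)))

theorem Syn.lift_map_op (hC : IsCartesianClosed C) {ns : List ℕ} {m : ℕ} (o : S.Op ns m) :
    (Syn.lift O hC).map (Syn.homMk (.op o (.var .z))) = O ns m o :=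
  (hC.pair_snd_assoc _ _ _).trans (Category.id_comp _)

end Interpretation

-- Uniqueness of strict functors out of the syntactic category

section Uniqueness

theorem Syn.map_comp_heq {S : Sig.{u, v}} {C : Type u₁} [Category.{v₁} C] {F G : Syn S ⥤ C}
    (ho : ∀ τ : STy, F.obj ⟨τ⟩ = G.obj ⟨τ⟩) {τ σ ρ : STy}
    {f : (⟨τ⟩ : Syn S) ⟶ ⟨σ⟩} {g : (⟨σ⟩ : Syn S) ⟶ ⟨ρ⟩} (hf : F.map f ≍ G.map f)
    (hg : F.map g ≍ G.map g) : F.map (f ≫ g) ≍ G.map (f ≫ g) := by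
  rw [F.map_comp, G.map_comp]
  exact heq_comp (ho τ) (ho σ) (ho ρ) hf hg

variable {S : Sig.{u, v}} {C : Type u₁} [Category.{v₁} C] [CCOps C] {F G : Syn S ⥤ C}

/-- Supplies the map `k` required by `map_curry`, whose source is a product on the nose. -/
theorem exists_heq_of_eq {D : Type u₁} [Category.{v₁} D] {A B X : D} (h : A = B) (f : A ⟶ X) :
    ∃ g : B ⟶ X, f ≍ g := by
  subst h
  exact ⟨f, HEq.rfl⟩

theorem Syn.obj_eq (hF : IsCartesianClosedFunctor F) (hG : IsCartesianClosedFunctor G)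
    (h : ∀ n, F.obj ⟨.real n⟩ = G.obj ⟨.real n⟩) : ∀ τ : STy, F.obj ⟨τ⟩ = G.obj ⟨τ⟩
  | .real n => h n
  | .unit => hF.obj_one.trans hG.obj_one.symm
  | .prod τ σ => (hF.obj_prod ⟨τ⟩ ⟨σ⟩).trans
      ((congrArg₂ prod (obj_eq hF hG h τ) (obj_eq hF hG h σ)).trans (hG.obj_prod ⟨τ⟩ ⟨σ⟩).symm)
  | .fn τ σ => (hF.obj_exp ⟨τ⟩ ⟨σ⟩).trans
      ((congrArg₂ exp (obj_eq hF hG h τ) (obj_eq hF hG h σ)).trans (hG.obj_exp ⟨τ⟩ ⟨σ⟩).symm)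

/-- Functors only see terms in one variable, whereas induction on terms meets arbitrary contexts.
Closing `t` with a substitution into a context `[ρ]`, on whose components `F` and `G` already agree,
gives a statement that can be proved by induction. -/
theorem Syn.map_sub_heq (hC : IsCartesianClosed C) (hF : IsCartesianClosedFunctor F)
    (hG : IsCartesianClosedFunctor G) (ho : ∀ τ : STy, F.obj ⟨τ⟩ = G.obj ⟨τ⟩)
    (hop : ∀ (ns : List ℕ) (m : ℕ) (o : S.Op ns m),
      F.map (Syn.homMk (.op o (.var .z))) ≍ G.map (Syn.homMk (.op o (.var .z))))
    {Γ : List STy} {τ : STy} (t : STm S Γ τ) {ρ : STy} (θ : SSub S Γ [ρ])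
    (h : ∀ σ a, F.map (Syn.homMk (θ σ a)) ≍ G.map (Syn.homMk (θ σ a))) :
    F.map (Syn.homMk (t.sub θ)) ≍ G.map (Syn.homMk (t.sub θ)) := by
  have hS := Syn.isCartesianClosed S
  have hfst : ∀ τ σ : STy, F.map (fst (⟨τ⟩ : Syn S) ⟨σ⟩) ≍ G.map (fst (⟨τ⟩ : Syn S) ⟨σ⟩) :=
    fun τ σ => (hF.map_fst _ _).trans ((fst_heq (ho τ) (ho σ)).trans (hG.map_fst _ _).symm)
  have hsnd : ∀ τ σ : STy, F.map (snd (⟨τ⟩ : Syn S) ⟨σ⟩) ≍ G.map (snd (⟨τ⟩ : Syn S) ⟨σ⟩) :=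
    fun τ σ => (hF.map_snd _ _).trans ((snd_heq (ho τ) (ho σ)).trans (hG.map_snd _ _).symm)
  have hpair : ∀ {ρ τ σ : STy} (f : (⟨ρ⟩ : Syn S) ⟶ ⟨τ⟩) (g : (⟨ρ⟩ : Syn S) ⟶ ⟨σ⟩),
      F.map f ≍ G.map f → F.map g ≍ G.map g → F.map (pair f g) ≍ G.map (pair f g) :=
    fun f g hf hg => (hF.map_pair hS hC f g).trans
      ((pair_heq (ho _) (ho _) (ho _) hf hg).trans (hG.map_pair hS hC f g).symm)
  have hcurry : ∀ {τ σ ρ : STy} (f : prod (⟨ρ⟩ : Syn S) ⟨τ⟩ ⟶ ⟨σ⟩),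
      F.map f ≍ G.map f → F.map (curry f) ≍ G.map (curry f) := by
    intro τ σ ρ f hf
    obtain ⟨k, hk⟩ := exists_heq_of_eq (hF.obj_prod ⟨ρ⟩ ⟨τ⟩) (F.map f)
    obtain ⟨l, hl⟩ := exists_heq_of_eq (hG.obj_prod ⟨ρ⟩ ⟨τ⟩) (G.map f)
    exact (hF.map_curry hS hC f hk).trans ((curry_heq (ho _) (ho _) (ho _)
      (hk.symm.trans (hf.trans hl))).trans (hG.map_curry hS hC f hl).symm)
  induction t generalizing ρ with
  | var a => exact h _ a
  | op o t ih => exact Syn.map_comp_heq ho (ih θ h) (hop _ _ o)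
  | unit =>
    exact (hF.map_bang hC _).trans ((bang_heq (ho ρ)).trans (hG.map_bang hC ⟨ρ⟩).symm)
  | pair t s ih ih' =>
    exact hpair (Syn.homMk (t.sub θ)) (Syn.homMk (s.sub θ)) (ih θ h) (ih' θ h)
  | fst t ih => exact Syn.map_comp_heq ho (ih θ h) (hfst _ _)
  | snd t ih => exact Syn.map_comp_heq ho (ih θ h) (hsnd _ _)
  | @lam Γ τ σ t ih =>
    -- The bound variable is packed together with the old one: over `ρ * τ`, the old components are
    -- pulled back along `fst` and the bound variable becomes `snd`. The abstraction is then the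
    -- currying of `t.sub θ'`.
    let θ' : SSub S (τ :: Γ) [.prod ρ τ] :=
      SSub.cons (fun π a => (θ π a).sub (SSub.single (.fst (.var .z)))) (.snd (.var .z))
    have h' : ∀ π a, F.map (Syn.homMk (θ' π a)) ≍ G.map (Syn.homMk (θ' π a)) := by
      intro π a
      cases a with
      | z => exact hsnd _ _
      | s a => exact Syn.map_comp_heq ho (hfst _ _) (h _ a)
    have e : Syn.homMk ((STm.lam t).sub θ) =
        curry (A := (⟨ρ⟩ : Syn S)) (B := ⟨τ⟩) (X := ⟨σ⟩) (Syn.homMk (t.sub θ')) := by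
      refine SHom.sound (.lam ?_)
      rw [STm.sub_sub]
      refine .sub_right t fun π a => ?_
      cases a with
      | z => exact .symm (.snd_beta _ _)
      | s a =>
        change SEq ((θ π a).ren _) (((θ π a).sub _).sub _)
        rw [STm.ren_eq_sub, SSub.single_comp]
        refine .sub_right _ fun κ b => ?_
        rcases b with _ | b
        · exact .symm (.fst_beta _ _)
        · exact b.elim
    rw [e]
    exact hcurry _ (ih θ' h')
  | @app Γ τ σ t s ih ih' =>
    have e : Syn.homMk ((STm.app t s).sub θ) =
        pair (Syn.homMk (t.sub θ)) (Syn.homMk (s.sub θ)) ≫ ev (⟨τ⟩ : Syn S) ⟨σ⟩ :=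
      SHom.sound (.app (.symm (.fst_beta _ _)) (.symm (.snd_beta _ _)))
    rw [e]
    exact Syn.map_comp_heq ho (hpair _ _ (ih θ h) (ih' θ h))
      ((hF.map_ev _ _).trans ((ev_heq (ho _) (ho _)).trans (hG.map_ev _ _).symm))

/-- Cartesian closed functors from the syntactic category are determined by their values on the
types `realⁿ` and on the primitive operations. -/
theorem Syn.functor_ext (hC : IsCartesianClosed C) (hF : IsCartesianClosedFunctor F)
    (hG : IsCartesianClosedFunctor G) (h : ∀ n, F.obj ⟨.real n⟩ = G.obj ⟨.real n⟩)
    (hop : ∀ (ns : List ℕ) (m : ℕ) (o : S.Op ns m),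
      F.map (Syn.homMk (.op o (.var .z))) ≍ G.map (Syn.homMk (.op o (.var .z)))) : F = G := by
  have ho := Syn.obj_eq hF hG h
  refine CategoryTheory.Functor.hext (fun τ => ho τ.ty) ?_
  rintro ⟨τ⟩ ⟨σ⟩ ⟨t⟩
  -- The identity substitution recovers `t`; its only component is an identity morphism, on which
  -- functors agreeing on objects agree.
  have key := Syn.map_sub_heq hC hF hG ho hop t (SSub.id [τ]) fun π a => by
    rcases a with _ | a
    · refine (heq_of_eq (F.map_id ⟨τ⟩)).trans (HEq.trans ?_ (heq_of_eq (G.map_id ⟨τ⟩)).symm)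
      rw [ho τ]
    · exact a.elim
  rwa [STm.sub_id] at key

end Uniqueness

/-! ## The total categories of a model of the linear language are Cartesian closed -/

/-- The laws of a categorical model of the linear language: fibrewise biproducts which are preserved
by change of base, and natural bijections `psi`, `phi`, `lam`. -/
structure IsLinearModel {C : Type u₁} [Category.{v₁} C] [CCOps C]
    (L : LocallyIndexed.{u₁, v₁, u₂, v₂} C) [LinOps L] : Prop where
  bang_uniq {A : C} {X : L.Obj} (a : L.Hom A X LinOps.one) : a = LinOps.bang A X
  pair_fst {A : C} {X Y Z : L.Obj} (a : L.Hom A Z X) (b : L.Hom A Z Y) :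
    L.comp (LinOps.pair a b) (LinOps.fst A X Y) = a
  pair_snd {A : C} {X Y Z : L.Obj} (a : L.Hom A Z X) (b : L.Hom A Z Y) :
    L.comp (LinOps.pair a b) (LinOps.snd A X Y) = b
  pair_uniq {A : C} {X Y Z : L.Obj} (a : L.Hom A Z (LinOps.prod X Y)) :
    LinOps.pair (L.comp a (LinOps.fst A X Y)) (L.comp a (LinOps.snd A X Y)) = a
  map_fst {A B : C} (h : A ⟶ B) (X Y : L.Obj) : L.map h (LinOps.fst B X Y) = LinOps.fst A X Y
  map_snd {A B : C} (h : A ⟶ B) (X Y : L.Obj) : L.map h (LinOps.snd B X Y) = LinOps.snd A X Y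
  map_zero {A B : C} (h : A ⟶ B) (X Y : L.Obj) : L.map h (LinOps.zero B X Y) = LinOps.zero A X Y
  map_add {A B : C} (h : A ⟶ B) {X Y : L.Obj} (a b : L.Hom B X Y) :
    L.map h (LinOps.add a b) = LinOps.add (L.map h a) (L.map h b)
  zero_comp {A : C} {X Y Z : L.Obj} (a : L.Hom A Y Z) :
    L.comp (LinOps.zero A X Y) a = LinOps.zero A X Z
  comp_zero {A : C} {X Y Z : L.Obj} (a : L.Hom A X Y) :
    L.comp a (LinOps.zero A Y Z) = LinOps.zero A X Z
  add_comp {A : C} {X Y Z : L.Obj} (a b : L.Hom A X Y) (c : L.Hom A Y Z) :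
    L.comp (LinOps.add a b) c = LinOps.add (L.comp a c) (L.comp b c)
  comp_add {A : C} {X Y Z : L.Obj} (a : L.Hom A X Y) (b c : L.Hom A Y Z) :
    L.comp a (LinOps.add b c) = LinOps.add (L.comp a b) (L.comp a c)
  add_zero {A : C} {X Y : L.Obj} (a : L.Hom A X Y) : LinOps.add a (LinOps.zero A X Y) = a
  zero_add {A : C} {X Y : L.Obj} (a : L.Hom A X Y) : LinOps.add (LinOps.zero A X Y) a = a
  psiInv_psi {A B : C} {X Y : L.Obj} (a : L.Hom (prod A B) X Y) :
    LinOps.psiInv (LinOps.psi a) = a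
  psi_psiInv {A B : C} {X Y : L.Obj} (a : L.Hom A X (LinOps.fn B Y)) :
    LinOps.psi (LinOps.psiInv a) = a
  psiInv_comp {A B : C} {X Y Z : L.Obj} (a : L.Hom A X Y) (b : L.Hom A Y (LinOps.fn B Z)) :
    LinOps.psiInv (L.comp a b) = L.comp (L.map (fst A B) a) (LinOps.psiInv b)
  psiInv_map {A B D : C} (h : D ⟶ A) {X Y : L.Obj} (a : L.Hom A X (LinOps.fn B Y)) :
    LinOps.psiInv (L.map h a) = L.map (pair (fst D B ≫ h) (snd D B)) (LinOps.psiInv a)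
  phi_phiInv {A B : C} {X Y : L.Obj} (a : L.Hom (prod A B) X Y) :
    LinOps.phi (LinOps.phiInv a) = a
  phiInv_phi {A B : C} {X Y : L.Obj} (a : L.Hom A (LinOps.tens B X) Y) :
    LinOps.phiInv (LinOps.phi a) = a
  phi_comp {A B : C} {X Y Z : L.Obj} (a : L.Hom A (LinOps.tens B X) Y) (b : L.Hom A Y Z) :
    LinOps.phi (L.comp a b) = L.comp (LinOps.phi a) (L.map (fst A B) b)
  phi_map {A B D : C} (h : D ⟶ A) {X Y : L.Obj} (a : L.Hom A (LinOps.tens B X) Y) :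
    LinOps.phi (L.map h a) = L.map (pair (fst D B ≫ h) (snd D B)) (LinOps.phi a)
  lamInv_lam {A : C} {X Y : L.Obj} (a : L.Hom A X Y) : LinOps.lamInv (LinOps.lam a) = a
  lam_lamInv {A : C} {X Y : L.Obj} (f : A ⟶ LinOps.lolli X Y) : LinOps.lam (LinOps.lamInv f) = f
  lamInv_comp {A B : C} (h : A ⟶ B) {X Y : L.Obj} (f : B ⟶ LinOps.lolli X Y) :
    LinOps.lamInv (h ≫ f) = L.map h (LinOps.lamInv f)

namespace IsLinearModel

variable {C : Type u₁} [Category.{v₁} C] [CCOps C] {L : LocallyIndexed.{u₁, v₁, u₂, v₂} C}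
  [LinOps L]

theorem pair_fst_assoc (hL : IsLinearModel L) {A : C} {X Y Z W : L.Obj} (a : L.Hom A Z X)
    (b : L.Hom A Z Y) (c : L.Hom A X W) :
    L.comp (LinOps.pair a b) (L.comp (LinOps.fst A X Y) c) = L.comp a c := by
  rw [← L.assoc, hL.pair_fst]

theorem pair_snd_assoc (hL : IsLinearModel L) {A : C} {X Y Z W : L.Obj} (a : L.Hom A Z X)
    (b : L.Hom A Z Y) (c : L.Hom A Y W) :
    L.comp (LinOps.pair a b) (L.comp (LinOps.snd A X Y) c) = L.comp b c := by
  rw [← L.assoc, hL.pair_snd]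

theorem comp_pair (hL : IsLinearModel L) {A : C} {X Y Z W : L.Obj} (c : L.Hom A W Z)
    (a : L.Hom A Z X) (b : L.Hom A Z Y) :
    L.comp c (LinOps.pair a b) = LinOps.pair (L.comp c a) (L.comp c b) := by
  rw [← hL.pair_uniq (L.comp c (LinOps.pair a b)), L.assoc, L.assoc, hL.pair_fst, hL.pair_snd]

/-- Change of base preserves the projections, hence also the pairings they determine. -/
theorem map_pair (hL : IsLinearModel L) {A B : C} (h : A ⟶ B) {X Y Z : L.Obj}
    (a : L.Hom B Z X) (b : L.Hom B Z Y) :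
    L.map h (LinOps.pair a b) = LinOps.pair (L.map h a) (L.map h b) := by
  rw [← hL.pair_uniq (L.map h (LinOps.pair a b)), ← hL.map_fst h, ← hL.map_snd h, ← L.map_comp,
    ← L.map_comp, hL.pair_fst, hL.pair_snd]

theorem pair_fst_snd (hL : IsLinearModel L) (A : C) (X Y : L.Obj) :
    LinOps.pair (LinOps.fst A X Y) (LinOps.snd A X Y) = L.id A _ := by
  simpa only [L.id_comp] using hL.pair_uniq (L.id A (LinOps.prod X Y))

theorem add_pair (hL : IsLinearModel L) {A : C} {X Y Z : L.Obj} (a b : L.Hom A Z X)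
    (c d : L.Hom A Z Y) : LinOps.add (LinOps.pair a c) (LinOps.pair b d) =
      LinOps.pair (LinOps.add a b) (LinOps.add c d) := by
  rw [← hL.pair_uniq (LinOps.add (LinOps.pair a c) (LinOps.pair b d)), hL.add_comp, hL.add_comp,
    hL.pair_fst, hL.pair_fst, hL.pair_snd, hL.pair_snd]

/-- Joint injectivity of biproduct inclusions, in terms of components. -/
theorem coprod_uniq (hL : IsLinearModel L) {A : C} {X Y Z : L.Obj}
    (a : L.Hom A (LinOps.prod X Y) Z) :
    LinOps.add
      (L.comp (LinOps.fst A X Y) (L.comp (LinOps.pair (L.id A X) (LinOps.zero A X Y)) a))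
      (L.comp (LinOps.snd A X Y) (L.comp (LinOps.pair (LinOps.zero A Y X) (L.id A Y)) a)) = a := by
  -- The biproduct decomposition of the identity: `fst; ⟨id, 0⟩` and `snd; ⟨0, id⟩` add up to `⟨fst,
  -- snd⟩ = id`.
  rw [← L.assoc, ← L.assoc, ← hL.add_comp, hL.comp_pair, hL.comp_pair, hL.add_pair, L.comp_id,
    L.comp_id, hL.comp_zero, hL.comp_zero, hL.add_zero, hL.zero_add, hL.pair_fst_snd, L.id_comp]

/-- `psiInv` of the identity is the generic evaluation, and its restriction along `⟨𝟙, s⟩` is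
evaluation at the point `s`. Identities are stable under change of base, so by naturality of
`psiInv` evaluation is too. -/
theorem map_psi_eval (hC : IsCartesianClosed C) (hL : IsLinearModel L) {A B D : C} (h : D ⟶ A)
    (s : A ⟶ B) (Y : L.Obj) :
    L.map h (L.map (pair (𝟙 A) s) (LinOps.psiInv (L.id A (LinOps.fn B Y)))) =
      L.map (pair (𝟙 D) (h ≫ s)) (LinOps.psiInv (L.id D (LinOps.fn B Y))) := by
  rw [← L.map_id h, hL.psiInv_map, ← L.comp_map, ← L.comp_map, hC.comp_pair, hC.comp_pair,
    hC.pair_fst_assoc, hC.pair_snd, Category.comp_id, Category.id_comp]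

/-- A Yoneda argument: naturality of `psiInv` at the identity of `fn B Y` expresses every `psiInv a`
through the generic evaluation. -/
theorem psi_eval (hC : IsCartesianClosed C) (hL : IsLinearModel L) {A B D : C} (r : D ⟶ A)
    (s : D ⟶ B) {X Y : L.Obj} (a : L.Hom A X (LinOps.fn B Y)) :
    L.comp (L.map r a) (L.map (pair (𝟙 D) s) (LinOps.psiInv (L.id D (LinOps.fn B Y)))) =
      L.map (pair r s) (LinOps.psiInv a) := by
  have h := congrArg (L.map (pair (𝟙 D) s)) (hL.psiInv_comp (L.map r a) (L.id D (LinOps.fn B Y)))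
  rw [L.map_comp, ← L.comp_map, hC.pair_fst, L.id_map, L.comp_id, hL.psiInv_map, ← L.comp_map,
    hC.comp_pair, hC.pair_fst_assoc, hC.pair_snd, Category.id_comp] at h
  exact h.symm

/-- Dually, `phi` of the identity is the generic insertion `x ↦ !b ⊗ x`, restricted here to `b = s`;
it is stable under change of base for the same reason. -/
theorem map_phi_eval (hC : IsCartesianClosed C) (hL : IsLinearModel L) {A B D : C} (h : D ⟶ A)
    (s : A ⟶ B) (Y : L.Obj) :
    L.map h (L.map (pair (𝟙 A) s) (LinOps.phi (L.id A (LinOps.tens B Y)))) =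
      L.map (pair (𝟙 D) (h ≫ s)) (LinOps.phi (L.id D (LinOps.tens B Y))) := by
  rw [← L.map_id h, hL.phi_map, ← L.comp_map, ← L.comp_map, hC.comp_pair, hC.comp_pair,
    hC.pair_fst_assoc, hC.pair_snd, Category.comp_id, Category.id_comp]

/-- The Yoneda argument for `phi`: precomposing with the insertion at `s` computes `phi a` at `s`.
-/
theorem phi_eval (hC : IsCartesianClosed C) (hL : IsLinearModel L) {A B D : C} (r : D ⟶ A)
    (s : D ⟶ B) {X Y : L.Obj} (a : L.Hom A (LinOps.tens B X) Y) :
    L.comp (L.map (pair (𝟙 D) s) (LinOps.phi (L.id D (LinOps.tens B X)))) (L.map r a) =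
      L.map (pair r s) (LinOps.phi a) := by
  have h := congrArg (L.map (pair (𝟙 D) s)) (hL.phi_comp (L.id D (LinOps.tens B X)) (L.map r a))
  rw [L.map_comp, ← L.comp_map, hC.pair_fst, L.id_map, L.id_comp, hL.phi_map, ← L.comp_map,
    hC.comp_pair, hC.pair_fst_assoc, hC.pair_snd, Category.id_comp] at h
  exact h.symm

/-- The fibre component of `pair (fst ≫ g) snd ≫ ev` in `Σ_C L`. -/
theorem total_ev_fib (hC : IsCartesianClosed C) (hL : IsLinearModel L) {A B P : C}
    {X Y Z : L.Obj} (g : A ⟶ exp B (prod P (LinOps.lolli Y Z))) (a : L.Hom A X (LinOps.fn B Z)) :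
    L.comp (LinOps.pair (L.comp (LinOps.fst (prod A B) X Y) (L.map (fst A B) a))
        (LinOps.snd (prod A B) X Y))
      (L.map (pair (fst A B ≫ g) (snd A B)) (LinOps.add
        (L.comp (LinOps.fst _ (LinOps.fn B Z) Y)
          (L.map (pair (𝟙 _) (snd _ B)) (LinOps.psiInv (L.id _ (LinOps.fn B Z)))))
        (L.comp (LinOps.snd _ (LinOps.fn B Z) Y) (LinOps.lamInv (ev B _ ≫ snd P _))))) =
    LinOps.add (L.comp (LinOps.fst _ X Y) (LinOps.psiInv a))
      (L.comp (LinOps.snd _ X Y)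
        (LinOps.lamInv (pair (fst A B ≫ g) (snd A B) ≫ ev B _ ≫ snd P _))) := by
  -- The environment is `fst` and the point of evaluation is `snd`, so `psi_eval` restricts `psiInv
  -- a` along `⟨fst, snd⟩ = 𝟙`.
  rw [hL.map_add, L.map_comp, L.map_comp, hL.map_fst, hL.map_snd, hL.comp_add,
    hL.pair_fst_assoc, hL.pair_snd_assoc, hL.map_psi_eval hC, hC.pair_snd, L.assoc,
    hL.psi_eval hC, hC.pair_fst_snd, L.id_map, hL.lamInv_comp (pair (fst A B ≫ g) (snd A B))]

/-- The fibre component of `pair (fst ≫ g) snd ≫ ev` in `Σ_C Lᵒᵖ`. -/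
theorem totalOp_ev_fib (hC : IsCartesianClosed C) (hL : IsLinearModel L) {A B P : C}
    {X Y Z : L.Obj} (g : A ⟶ exp B (prod P (LinOps.lolli Z Y))) (a : L.Hom A (LinOps.tens B Z) X) :
    L.comp (L.map (pair (fst A B ≫ g) (snd A B)) (LinOps.pair
        (L.map (pair (𝟙 _) (snd _ B)) (LinOps.phi (L.id _ (LinOps.tens B Z))))
        (LinOps.lamInv (ev B _ ≫ snd P _))))
      (LinOps.add (L.comp (LinOps.fst _ (LinOps.tens B Z) Y)
          (L.comp (L.map (fst A B) a) (LinOps.pair (L.id _ X) (LinOps.zero _ X Y))))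
        (L.comp (LinOps.snd _ (LinOps.tens B Z) Y)
          (LinOps.pair (LinOps.zero _ Y X) (L.id _ Y)))) =
    LinOps.pair (LinOps.phi a)
      (LinOps.lamInv (pair (fst A B ≫ g) (snd A B) ≫ ev B _ ≫ snd P _)) := by
  -- Composing with the copairing selects each summand; `phi_eval` at `⟨fst, snd⟩ = 𝟙` then yields
  -- `phi a`, and adding the two inclusions gives a pair.
  rw [hL.map_pair, hL.comp_add, hL.pair_fst_assoc, hL.pair_snd_assoc, hL.map_phi_eval hC,
    hC.pair_snd, ← L.assoc, hL.phi_eval hC, hC.pair_fst_snd, L.id_map, hL.comp_pair, hL.comp_pair,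
    hL.add_pair, L.comp_id, L.comp_id, hL.comp_zero, hL.comp_zero, hL.add_zero, hL.zero_add,
    hL.lamInv_comp (pair (fst A B ≫ g) (snd A B))]

/-- `fst; a + snd; b` is the copairing of `a` and `b`, so the first inclusion recovers `a`: the
biproduct is also a coproduct. -/
theorem inl_add (hL : IsLinearModel L) {A : C} {X Y Z : L.Obj} (a : L.Hom A X Z)
    (b : L.Hom A Y Z) : L.comp (LinOps.pair (L.id A X) (LinOps.zero A X Y))
      (LinOps.add (L.comp (LinOps.fst A X Y) a) (L.comp (LinOps.snd A X Y) b)) = a := by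
  rw [hL.comp_add, hL.pair_fst_assoc, hL.pair_snd_assoc, L.id_comp, hL.zero_comp, hL.add_zero]

theorem inr_add (hL : IsLinearModel L) {A : C} {X Y Z : L.Obj} (a : L.Hom A X Z)
    (b : L.Hom A Y Z) : L.comp (LinOps.pair (LinOps.zero A Y X) (L.id A Y))
      (LinOps.add (L.comp (LinOps.fst A X Y) a) (L.comp (LinOps.snd A X Y) b)) = b := by
  rw [hL.comp_add, hL.pair_fst_assoc, hL.pair_snd_assoc, L.id_comp, hL.zero_comp, hL.zero_add]

/-- Transposing back the linear part that was stored in the base component of a curried morphism. -/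
theorem lamInv_curry (hC : IsCartesianClosed C) (hL : IsLinearModel L) {A B P : C} {X Y : L.Obj}
    (f : prod A B ⟶ P) (a : L.Hom (prod A B) X Y) :
    LinOps.lamInv (pair (fst A B ≫ curry (pair f (LinOps.lam a))) (snd A B) ≫
      ev B (prod P (LinOps.lolli X Y)) ≫ snd P _) = a := by
  rw [hC.curry_ev_assoc, hC.pair_snd, hL.lamInv_lam]

/-- A map into the base of an exponential is recovered from its two uncurried components. The linear
one is a variable `a` with an equation, since in the uniqueness laws it arises as a summand or
component of the fibre of an evaluation. -/
theorem curry_lam (hC : IsCartesianClosed C) (hL : IsLinearModel L) {A B P : C} {X Y : L.Obj}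
    (g : A ⟶ exp B (prod P (LinOps.lolli X Y))) {a : L.Hom (prod A B) X Y}
    (ha : a = LinOps.lamInv (pair (fst A B ≫ g) (snd A B) ≫ ev B _ ≫ snd P _)) :
    curry (pair (pair (fst A B ≫ g) (snd A B) ≫ ev B _ ≫ fst P _) (LinOps.lam a)) = g := by
  rw [ha, hL.lam_lamInv, ← Category.assoc, ← Category.assoc, hC.pair_uniq, hC.curry_uniq]

/-- Each law splits into a base and a fibre equation. For exponentials, `inl_add` and `inr_add`
separate the fibre of an uncurried map into what `psi` and `lam` encode, and `coprod_uniq` puts the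
parts back together. -/
theorem isCartesianClosed_total (hC : IsCartesianClosed C) (hL : IsLinearModel L) :
    IsCartesianClosed (Total L) where
  bang_uniq _ := Total.Hom.ext (hC.bang_uniq _) (hL.bang_uniq _)
  pair_fst f g := Total.Hom.ext (hC.pair_fst _ _)
    ((congrArg (L.comp _) (hL.map_fst _ _ _)).trans (hL.pair_fst f.fib g.fib))
  pair_snd f g := Total.Hom.ext (hC.pair_snd _ _)
    ((congrArg (L.comp _) (hL.map_snd _ _ _)).trans (hL.pair_snd f.fib g.fib))
  pair_uniq h := Total.Hom.ext (hC.pair_uniq _)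
    ((congrArg₂ LinOps.pair (congrArg (L.comp h.fib) (hL.map_fst _ _ _))
      (congrArg (L.comp h.fib) (hL.map_snd _ _ _))).trans (hL.pair_uniq h.fib))
  curry_ev f := Total.Hom.ext ((hC.curry_ev_assoc _ _).trans (hC.pair_fst _ _))
    ((hL.total_ev_fib hC _ _).trans ((congrArg₂ (fun a b => LinOps.add (L.comp _ a) (L.comp _ b))
      (hL.psiInv_psi _) (hL.lamInv_curry hC _ _)).trans (hL.coprod_uniq f.fib)))
  curry_uniq g := Total.Hom.ext
    (hL.curry_lam hC g.base
      ((congrArg (L.comp _) (hL.total_ev_fib hC _ g.fib)).trans (hL.inr_add _ _)))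
    ((congrArg LinOps.psi
      ((congrArg (L.comp _) (hL.total_ev_fib hC _ g.fib)).trans (hL.inl_add _ _))).trans
        (hL.psi_psiInv g.fib))

/-- Fibre maps are reversed, so products of the total category use the coproduct half of the
biproducts, while currying splits a fibre map by the product half. -/
theorem isCartesianClosed_totalOp (hC : IsCartesianClosed C) (hL : IsLinearModel L) :
    IsCartesianClosed (TotalOp L) where
  bang_uniq {A} f := TotalOp.Hom.ext (hC.bang_uniq _) (by
    -- The fibrewise terminal object is also initial, as its identity is zero; this is what
    -- terminality in the opposite fibre needs.
    have h : L.id A.base LinOps.one = LinOps.zero A.base LinOps.one LinOps.one :=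
      (hL.bang_uniq _).trans (hL.bang_uniq _).symm
    exact (L.id_comp f.fib).symm.trans ((congrArg (L.comp · f.fib) h).trans (hL.zero_comp f.fib)))
  pair_fst f g := TotalOp.Hom.ext (hC.pair_fst _ _)
    ((congrArg (L.comp · _) ((hL.map_pair _ _ _).trans
      (congrArg₂ LinOps.pair (L.map_id _ _) (hL.map_zero _ _ _)))).trans (hL.inl_add f.fib g.fib))
  pair_snd f g := TotalOp.Hom.ext (hC.pair_snd _ _)
    ((congrArg (L.comp · _) ((hL.map_pair _ _ _).trans
      (congrArg₂ LinOps.pair (hL.map_zero _ _ _) (L.map_id _ _)))).trans (hL.inr_add f.fib g.fib))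
  pair_uniq h := TotalOp.Hom.ext (hC.pair_uniq _)
    ((congrArg₂ (fun a b => LinOps.add (L.comp _ (L.comp a h.fib)) (L.comp _ (L.comp b h.fib)))
      ((hL.map_pair _ _ _).trans (congrArg₂ LinOps.pair (L.map_id _ _) (hL.map_zero _ _ _)))
      ((hL.map_pair _ _ _).trans (congrArg₂ LinOps.pair (hL.map_zero _ _ _) (L.map_id _ _)))).trans
        (hL.coprod_uniq h.fib))
  curry_ev f := TotalOp.Hom.ext ((hC.curry_ev_assoc _ _).trans (hC.pair_fst _ _))
    ((hL.totalOp_ev_fib hC _ _).trans ((congrArg₂ LinOps.pair (hL.phi_phiInv _)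
      (hL.lamInv_curry hC _ _)).trans (hL.pair_uniq f.fib)))
  curry_uniq g := TotalOp.Hom.ext
    (hL.curry_lam hC g.base
      ((congrArg (L.comp · _) (hL.totalOp_ev_fib hC _ g.fib)).trans (hL.pair_snd _ _)))
    ((congrArg LinOps.phiInv
      ((congrArg (L.comp · _) (hL.totalOp_ev_fib hC _ g.fib)).trans (hL.pair_fst _ _))).trans
        (hL.phiInv_phi g.fib))

end IsLinearModel

/-! ## The syntactic model of the target language -/

theorem THom.sound {S : Sig.{u, v}} {τ : CTy} {j : Jdg} {t s : Tm S [τ] j} (h : TEq t s) :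
    THom.mk t = THom.mk s := Quotient.sound (s := Tm.setoid S [τ] j) h

theorem TEq.of_eq {S : Sig.{u, v}} {Γ : List CTy} {j : Jdg} {t s : Tm S Γ j} (h : t = s) :
    TEq t s := h ▸ .refl t

/-- Substitutions for a context with a single variable are determined by the value of the variable,
up to equality. -/
theorem TEq.sub_single {S : Sig.{u, v}} {Γ : List CTy} {σ : CTy} {j : Jdg} (t : Tm S [σ] j)
    {θ θ' : Sub S [σ] Γ} (h : TEq (θ σ .z) (θ' σ .z)) : TEq (t.sub θ) (t.sub θ') := by
  refine .sub_right t fun κ b => ?_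
  rcases b with _ | b
  · exact h
  · exact b.elim

theorem TEq.sub_single_id {S : Sig.{u, v}} {σ : CTy} {j : Jdg} (t : Tm S [σ] j)
    {θ : Sub S [σ] [σ]} (h : TEq (θ σ .z) (.var .z)) : TEq (t.sub θ) t := by
  have key := TEq.sub_single t (θ' := Sub.id [σ]) h
  rwa [Tm.sub_id] at key

/-- Surjective pairing, for a variable of product type in a judgement. -/
theorem TEq.pairSub_inst {S : Sig.{u, v}} {τ σ : CTy} {j : Jdg} (t : Tm S [.prod τ σ] j) :
    TEq (((t.sub (THom.pairSub τ σ)).sub ((THom.fstSub τ σ).lift σ)).inst (.snd (.var .z))) t := by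
  refine .trans (.of_eq ((Tm.sub_sub _ _ _).trans (Tm.sub_sub _ _ _))) ?_
  exact .sub_single_id t (.symm (.pair_eta _))

/-- Substituting a pair for the variable of a weakened term. -/
theorem TEq.fstSub_pairSub {S : Sig.{u, v}} {τ σ : CTy} {j : Jdg} (t : Tm S [τ] j) :
    TEq ((t.sub (THom.fstSub τ σ)).sub (THom.pairSub τ σ)) (t.ren (Ren.wk [τ] σ)) := by
  rw [Tm.sub_sub, Tm.ren_eq_sub]
  exact .sub_single t (.fst_beta _ _)

theorem CSyn.isCartesianClosed (S : Sig.{u, v}) : IsCartesianClosed (CSyn S) where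
  bang_uniq f := by
    rcases f with ⟨t⟩
    exact THom.sound (.unit_eta t)
  pair_fst f g := by
    rcases f with ⟨t⟩
    rcases g with ⟨s⟩
    exact THom.sound (.fst_beta t s)
  pair_snd f g := by
    rcases f with ⟨t⟩
    rcases g with ⟨s⟩
    exact THom.sound (.snd_beta t s)
  pair_uniq h := by
    rcases h with ⟨t⟩
    exact THom.sound (.symm (.pair_eta t))
  curry_ev {A B X} f := by
    rcases f with ⟨t⟩
    refine THom.sound (.trans (.app (.fst_beta _ _) (.snd_beta _ _)) (.trans (.lam_beta _ _) ?_))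
    exact TEq.pairSub_inst t
  curry_uniq {A B X} g := by
    rcases g with ⟨t⟩
    refine THom.sound (.trans (.lam ?_) (.symm (.lam_eta t)))
    exact .app (.trans (.fst_beta _ _) (TEq.fstSub_pairSub t))
      (.trans (.snd_beta _ _) (.snd_beta _ _))

/-- Composition `a; b` substitutes `a` for the linear variable of `b`. Hence additivity in `b` is
definitional, while additivity in `a` is exactly the pair of homomorphism laws `lsub_zero` and
`lsub_add`. -/
theorem LSyn.isLinearModel (S : Sig.{u, v}) : IsLinearModel (LSyn S) where
  bang_uniq a := by
    rcases a with ⟨t⟩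
    exact THom.sound (.lunit_eta t)
  pair_fst a b := by
    rcases a with ⟨t⟩
    rcases b with ⟨s⟩
    exact THom.sound (.lfst_beta t s)
  pair_snd a b := by
    rcases a with ⟨t⟩
    rcases b with ⟨s⟩
    exact THom.sound (.lsnd_beta t s)
  pair_uniq a := by
    rcases a with ⟨t⟩
    exact THom.sound (.symm (.lpair_eta t))
  map_fst h X Y := by
    rcases h with ⟨r⟩
    rfl
  map_snd h X Y := by
    rcases h with ⟨r⟩
    rfl
  map_zero h X Y := by
    rcases h with ⟨r⟩
    rfl
  map_add h X Y a b := by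
    rcases h with ⟨r⟩
    rcases a with ⟨t⟩
    rcases b with ⟨s⟩
    rfl
  zero_comp a := by
    rcases a with ⟨t⟩
    exact THom.sound (.lsub_zero t)
  comp_zero a := by
    rcases a with ⟨t⟩
    rfl
  add_comp a b c := by
    rcases a with ⟨t⟩
    rcases b with ⟨s⟩
    rcases c with ⟨r⟩
    exact THom.sound (.lsub_add r t s)
  comp_add a b c := by
    rcases a with ⟨t⟩
    rcases b with ⟨s⟩
    rcases c with ⟨r⟩
    rfl
  add_zero a := by
    rcases a with ⟨t⟩
    exact THom.sound (.add_zero t)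
  zero_add a := by
    rcases a with ⟨t⟩
    exact THom.sound (.zero_add t)
  psiInv_psi a := by
    rcases a with ⟨t⟩
    exact THom.sound (.trans (.lfun_beta _ _) (TEq.pairSub_inst t))
  psi_psiInv {A B X Y} a := by
    rcases a with ⟨t⟩
    refine THom.sound (.trans (.lfun ?_) (.symm (.lfun_eta t)))
    exact .lfunApp (TEq.fstSub_pairSub t) (.snd_beta _ _)
  psiInv_comp a b := by
    rcases a with ⟨t⟩
    rcases b with ⟨s⟩
    exact congrArg (fun r => THom.mk (Tm.lfunApp r _)) (Tm.lsub_sub s t _)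
  psiInv_map {A B D} h X Y a := by
    rcases h with ⟨r⟩
    rcases a with ⟨t⟩
    refine THom.sound (.lfunApp ?_ (.symm (.snd_beta _ _)))
    change TEq ((t.sub _).sub _) ((t.sub _).sub _)
    rw [Tm.sub_sub, Tm.sub_sub]
    exact .sub_single t (.symm (.fst_beta _ _))
  phi_phiInv {A B X Y} a := by
    rcases a with ⟨t⟩
    refine THom.sound (.trans (.tens_beta _ _ _) ?_)
    exact .trans (.of_eq (Tm.lsub_lvar _)) (TEq.pairSub_inst t)
  phiInv_phi {A B X Y} a := by
    rcases a with ⟨t⟩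
    -- The `η`-law of `!(-) ⊗ (-)` is used with the linear variable itself as scrutinee.
    refine THom.sound (.trans (.tensCase (.refl _) ?_) (.trans (.symm (.tens_eta t .lvar)) ?_))
    · exact .trans (.of_eq (Tm.lsub_sub _ _ _)) (.trans (.lsub_left (TEq.fstSub_pairSub t) _)
        (.lsub_right _ (.tens (.snd_beta _ _) (.refl _))))
    · exact .of_eq (Tm.lsub_lvar _)
  phi_comp a b := by
    rcases a with ⟨t⟩
    rcases b with ⟨s⟩
    exact congrArg THom.mk ((congrArg (Tm.lsub · _) (Tm.lsub_sub s t _)).trans (Tm.lsub_lsub _ _ _))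
  phi_map {A B D} h X Y a := by
    rcases h with ⟨r⟩
    rcases a with ⟨t⟩
    refine THom.sound ?_
    -- The side with the restricted `phi` contains the redexes, so the equation is reduced from
    -- right to left.
    refine .symm (.trans (.of_eq (Tm.lsub_sub _ _ _)) (.trans (.lsub_left ?_ _)
      (.lsub_right _ (.tens (.snd_beta _ _) (.refl _)))))
    exact .trans (.of_eq (Tm.sub_sub _ _ _)) (.trans (.sub_single t
      (θ' := fun κ b => (Sub.single r κ b).sub (THom.fstSub D.ty B.ty)) (.fst_beta _ _))
        (.of_eq (Tm.sub_sub _ _ _).symm))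
  lamInv_lam a := by
    rcases a with ⟨t⟩
    exact THom.sound (.trans (.lolli_beta t _) (.of_eq (Tm.lsub_lvar t)))
  lam_lamInv f := by
    rcases f with ⟨t⟩
    exact THom.sound (.symm (.lolli_eta t))
  lamInv_comp h X Y f := by
    rcases h with ⟨r⟩
    rcases f with ⟨t⟩
    rfl

/-! ## Automatic differentiation -/

theorem Fwd.isCartesianClosed (S : Sig.{u, v}) : IsCartesianClosed (Fwd S) :=
  (LSyn.isLinearModel S).isCartesianClosed_total (CSyn.isCartesianClosed S)

theorem Rev.isCartesianClosed (S : Sig.{u, v}) : IsCartesianClosed (Rev S) :=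
  (LSyn.isLinearModel S).isCartesianClosed_totalOp (CSyn.isCartesianClosed S)

/-- The domain types are defined by recursion on the list, so this identification is not
definitional for a variable list. It is what lets `Dop` serve as interpretation data. -/
theorem Fwd.interp_dom (S : Sig.{u, v}) : ∀ ns : List ℕ,
    (STy.dom ns).interp (fun n => (⟨⟨.real n⟩, .real n⟩ : Fwd S)) = ⟨⟨CTy.dom ns⟩, LTy.dom ns⟩
  | [] => rfl
  | [_] => rfl
  | n :: m :: ns => congrArg (prod (⟨⟨.real n⟩, .real n⟩ : Fwd S)) (interp_dom S (m :: ns))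

theorem Rev.interp_dom (S : Sig.{u, v}) : ∀ ns : List ℕ,
    (STy.dom ns).interp (fun n => (⟨⟨.real n⟩, .real n⟩ : Rev S)) = ⟨⟨CTy.dom ns⟩, LTy.dom ns⟩
  | [] => rfl
  | [_] => rfl
  | n :: m :: ns => congrArg (prod (⟨⟨.real n⟩, .real n⟩ : Rev S)) (interp_dom S (m :: ns))

/-- The universal property of the syntactic category: a Cartesian closed functor to `C` is given by
its values on the types `realⁿ` and on the primitive operations. -/
theorem Syn.existsUnique_functor {S : Sig.{u, v}} {C : Type u₁} [Category.{v₁} C] [CCOps C]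
    (hC : IsCartesianClosed C) (R : ℕ → C) (dom : List ℕ → C)
    (hdom : ∀ ns, (STy.dom ns).interp R = dom ns)
    (O : ∀ (ns : List ℕ) (m : ℕ), S.Op ns m → (dom ns ⟶ R m)) :
    ∃! F : Syn S ⥤ C, IsCartesianClosedFunctor F ∧ (∀ n, F.obj ⟨.real n⟩ = R n) ∧
      ∀ (ns : List ℕ) (m : ℕ) (o : S.Op ns m),
        F.map (Syn.homMk (.op o (.var .z))) ≍ O ns m o := by
  -- As `dom` is a variable, the propositional identification of domains is eliminated, and `O`
  -- becomes an interpretation of the operations.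
  obtain rfl : (fun ns => (STy.dom ns).interp R) = dom := funext hdom
  refine ⟨Syn.lift O hC, ⟨Syn.lift_isCartesianClosedFunctor O hC, fun _ => rfl,
    fun ns m o => heq_of_eq (Syn.lift_map_op O hC o)⟩, ?_⟩
  rintro G ⟨hG, hR, hop⟩
  exact Syn.functor_ext hC hG (Syn.lift_isCartesianClosedFunctor O hC) hR fun ns m o =>
    (hop ns m o).trans (heq_of_eq (Syn.lift_map_op O hC o)).symm

theorem existsUnique_isForwardAD {S : Sig.{u, v}} (Dop : DerivativeTerms S) :
    ∃! D : Syn S ⥤ Fwd S, IsForwardAD Dop D := by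
  obtain ⟨F, ⟨hF, hR, hop⟩, huniq⟩ := Syn.existsUnique_functor (S := S) (Fwd.isCartesianClosed S)
    (fun n => ⟨⟨.real n⟩, .real n⟩) _ (Fwd.interp_dom S)
    fun ns m o => Fwd.homMk (.op o (.var .z)) (Dop ns m o)
  exact ⟨F, ⟨hF, hR, hop⟩, fun G hG => huniq G ⟨hG.cartesianClosed, hG.obj_real, hG.map_op⟩⟩

theorem existsUnique_isReverseAD {S : Sig.{u, v}} (Dopt : TransposedDerivativeTerms S) :
    ∃! D : Syn S ⥤ Rev S, IsReverseAD Dopt D := by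
  obtain ⟨F, ⟨hF, hR, hop⟩, huniq⟩ := Syn.existsUnique_functor (S := S) (Rev.isCartesianClosed S)
    (fun n => ⟨⟨.real n⟩, .real n⟩) _ (Rev.interp_dom S)
    fun ns m o => Rev.homMk (.op o (.var .z)) (Dopt ns m o)
  exact ⟨F, ⟨hF, hR, hop⟩, fun G hG => huniq G ⟨hG.cartesianClosed, hG.obj_real, hG.map_op⟩⟩

/-- `TEq` is an equivalence relation by construction, so equality in the quotient reflects back to
terms. -/
theorem THom.exact {S : Sig.{u, v}} {τ : CTy} {j : Jdg} {t s : Tm S [τ] j}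
    (h : THom.mk t = THom.mk s) : TEq t s := Quotient.exact (s := Tm.setoid S [τ] j) h

theorem Fwd.homMk_inj {S : Sig.{u, v}} {τ₁ σ₁ : CTy} {τ₂ σ₂ : LTy} {t₁ s₁ : Tm S [τ₁] (.cart σ₁)}
    {t₂ s₂ : Tm S [τ₁] (.lin τ₂ σ₂)} (h : Fwd.homMk t₁ t₂ = Fwd.homMk s₁ s₂) :
    TEq t₁ s₁ ∧ TEq t₂ s₂ :=
  ⟨THom.exact (congrArg Total.Hom.base h), THom.exact (congrArg Total.Hom.fib h)⟩

theorem Rev.homMk_inj {S : Sig.{u, v}} {τ₁ σ₁ : CTy} {τ₂ σ₂ : LTy} {t₁ s₁ : Tm S [τ₁] (.cart σ₁)}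
    {t₂ s₂ : Tm S [τ₁] (.lin σ₂ τ₂)} (h : Rev.homMk t₁ t₂ = Rev.homMk s₁ s₂) :
    TEq t₁ s₁ ∧ TEq t₂ s₂ :=
  ⟨THom.exact (congrArg TotalOp.Hom.base h), THom.exact (congrArg TotalOp.Hom.fib h)⟩

end AD

theorem mainTheorem4 (S : Sig.{u, v}) (Dop : DerivativeTerms S)
    (Dopt : TransposedDerivativeTerms S) :
    IsCartesianClosed (Syn S) ∧ IsCartesianClosed (Fwd S) ∧ IsCartesianClosed (Rev S) ∧
    (∃! D : Syn S ⥤ Fwd S, IsForwardAD Dop D) ∧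
    (∃! Drev : Syn S ⥤ Rev S, IsReverseAD Dopt Drev) ∧
    (∀ D : Syn S ⥤ Fwd S, IsForwardAD Dop D →
      ∀ (τ σ : STy) (t s : STm S [τ] σ), SEq t s →
      ∀ (t₁ s₁ : Tm S [(D.obj ⟨τ⟩).base.ty] (.cart (D.obj ⟨σ⟩).base.ty))
        (t₂ s₂ : Tm S [(D.obj ⟨τ⟩).base.ty] (.lin (D.obj ⟨τ⟩).fib (D.obj ⟨σ⟩).fib)),
      D.map (Syn.homMk t) = Fwd.homMk t₁ t₂ → D.map (Syn.homMk s) = Fwd.homMk s₁ s₂ →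
      TEq t₁ s₁ ∧ TEq t₂ s₂) ∧
    (∀ Drev : Syn S ⥤ Rev S, IsReverseAD Dopt Drev →
      ∀ (τ σ : STy) (t s : STm S [τ] σ), SEq t s →
      ∀ (t₁ s₁ : Tm S [(Drev.obj ⟨τ⟩).base.ty] (.cart (Drev.obj ⟨σ⟩).base.ty))
        (t₂ s₂ : Tm S [(Drev.obj ⟨τ⟩).base.ty] (.lin (Drev.obj ⟨σ⟩).fib (Drev.obj ⟨τ⟩).fib)),
      Drev.map (Syn.homMk t) = Rev.homMk t₁ t₂ → Drev.map (Syn.homMk s) = Rev.homMk s₁ s₂ →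
      TEq t₁ s₁ ∧ TEq t₂ s₂) := by

  refine ⟨Syn.isCartesianClosed S, Fwd.isCartesianClosed S, Rev.isCartesianClosed S,
    existsUnique_isForwardAD Dop, existsUnique_isReverseAD Dopt, ?_, ?_⟩
  · intro D _ τ σ t s h t₁ s₁ t₂ s₂ ht hs
    -- The two programs are one morphism of `Syn S`, so both pairs of terms represent its image
    -- under `D`.
    exact Fwd.homMk_inj (ht.symm.trans ((congrArg D.map (SHom.sound h)).trans hs))
  · intro D _ τ σ t s h t₁ s₁ t₂ s₂ ht hs
    exact Rev.homMk_inj (ht.symm.trans ((congrArg D.map (SHom.sound h)).trans hs))
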